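/- Setting. Let $R$ be a commutative Hausdorff topological ring containing $\mathbb Q$ ("functions of $t=(t_1=x,t_2,\dots)$"), with commuting derivations $\partial_n=\partial/\partial t_n$ ($n\ge1$), $\partial=\partial_1$ continuous, and elements $t_n\in R$ with $\partial_m t_n=\delta_{mn}$. Pseudo-differential operators $\sum_{n\le N}a_nD^n$ over $R$ are multiplied by the generalized Leibniz rule; $A_+$ and $A_-$ denote the parts of order $\ge 0$ and $<0$, $A(f)$ is the action on a function and $A^*$ the formal adjoint. Let $r\ge1$ and let $L$ be a Lax operator of the ${\sf cKP}_{r,1}$ hierarchy: $L=WD^rW^{-1}=L_++\Phi D^{-1}\Psi$, with $W=1+\sum_{n\ge1}w_nD^{-n}$, $L^{l/r}=WD^lW^{-1}$, $\partial_nW=-(L^{n/r})_-W$, $\partial_n\Phi=(L^{n/r})_+(\Phi)$, $\partial_n\Psi=-\big((L^{n/r})_+\big)^*(\Psi)$ for all $n\ge 1$, where $\Phi,\Psi$ are invertible in $R$. Let $M=W\big(\sum_{l\ge1}\frac lr t_lD^{l-r}+E\big)W^{-1}$, where $E$ is a pseudo-differential operator whose coefficients are constant in all the times; infinite sums are taken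 term by term in $l$ and coefficient by coefficient. Put $L(f)=L_+(f)+\Phi\,\partial^{-1}(\Psi f)$ and $L^*(g)=(L_+)^*(g)-\Psi\,\partial^{-1}(\Phi g)$. Suppose that antiderivatives $\Omega_{ij}=\partial^{-1}\big(L^i(\Phi)\,(L^*)^j(\Psi)\big)\in R$ are given and used in forming the iterates $L^n(\Phi)$, $(L^*)^n(\Psi)$, with integration constants compatible with integration by parts: $$\Omega_{i+1,j}-\Omega_{i,j+1}=B\big(L^i(\Phi),(L^*)^j(\Psi)\big)+\Omega_{i0}\Omega_{0j},$$ where, for $L_+=\sum_n a_nD^n$, $B(f,g)=\sum_{n}\sum_{m<n}(-1)^m(\partial^{n-1-m}f)\,\partial^m(a_ng)$ is the boundary term with $\partial B(f,g)=L_+(f)g-f(L_+)^*(g)$. (Differentiating this relation gives an identity, so it only fixes constants.) Put $$X^{(1)}_{K}=\sum_{j=0}^{K-1}\Big(j-\tfrac12(K-1)\Big)L^{K-1-j}(\Phi)\,D^{-1}\,(L^*)^j(\Psi),\qquad X^{(1)}_{0}=X^{(1)}_{-1}=0 .$$ Fix $k\ge0$, assume that the sums defining $(ML^k)_-$ converge,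 and let $\partial^*_k$ be a modified additional-symmetry flow, i.e. a derivation of $R$ commuting with $\partial$ such that $$\partial^*_kL=\big[-(ML^k)_-+X^{(1)}_{k-1},\,L\big].$$ Consider the Darboux–Bäcklund transformation $T=\Phi D\Phi^{-1}$: $\widetilde L=TLT^{-1}$, $\widetilde M=TMT^{-1}$, $\widetilde W=TWD^{-1}$, $\widetilde\Phi=T(L(\Phi))$, $\widetilde\Psi=\Phi^{-1}$. Let $\widetilde X^{(1)}_{K}$ be formed like $X^{(1)}_K$ from the transformed iterates $\widetilde L^n(\widetilde\Phi)=T(L^{n+1}(\Phi))$ and $(\widetilde L^*)^{n+1}(\widetilde\Psi)=-\Phi^{-1}\partial^{-1}\big(\Phi\,(L^*)^n(\Psi)\big)=-\Phi^{-1}\Omega_{0n}$. Proposition. The transformed data $\widetilde L,\widetilde W,\widetilde\Phi,\widetilde\Psi$ again form a solution of ${\sf cKP}_{r,1}$; the transformed iterates are iterates of $\widetilde L,\widetilde L^*$ on $\widetilde\Phi,\widetilde\Psi$ with compatible integration constants, namely for $\widetilde\Omega_{i0}=\Phi^{-1}L^{i+1}(\Phi)$, $\widetilde\Omega_{i,j+1}=\Omega_{i+1,j}-\Phi^{-1}L^{i+1}(\Phi)\,\Omega_{0j}$;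 and the sums defining $(\widetilde M\widetilde L^k)_-$ converge. The flow $\partial^*_k$ commutes with the Darboux–Bäcklund transformation up to an ordinary isospectral flow: $$\partial^*_k\widetilde L=-\Big[(\widetilde M\widetilde L^k)_--\widetilde X^{(1)}_{k-1},\,\widetilde L\Big]+\frac{\partial\widetilde L}{\partial t_{r(k-1)}},$$ where the last term is $0$ for $k=0,1$. If $\widetilde X^{(1)}_{k-1}$ is formed instead with any other compatible choice of the integration constants for $\widetilde L,\widetilde\Phi,\widetilde\Psi$, the formula holds up to adding $\sum_{j=1}^{k-2}c_j\,\partial\widetilde L/\partial t_{rj}$ with some $c_j\in R$, $\partial c_j=0$. -/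

import Mathlib

open scoped Differential

/-- A formal pseudo-differential operator `∑_{n ≤ N} aₙ Dⁿ`, where `D` stands for `∂ = ∂/∂x` and
the coefficients are written to the left; `coeff n` is `aₙ`. -/
@[ext]
structure PDO (R : Type*) [CommRing R] where
  coeff : ℤ → R
  bdd : ∃ N : ℤ, ∀ n, N < n → coeff n = 0

/-- The `j`-th derivative `∂ʲ f`. -/
def dx {R : Type*} [CommRing R] [Differential R] (j : ℕ) (f : R) : R := (fun g : R => g′)^[j] f

namespace PDO

section Additive

variable {R : Type*} [CommRing R]

instance : Zero (PDO R) := ⟨⟨fun _ => 0, 0, fun _ _ => rfl⟩⟩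

instance : Add (PDO R) :=
  ⟨fun A B => ⟨fun n => A.coeff n + B.coeff n, by
    obtain ⟨N, hN⟩ := A.bdd
    obtain ⟨M, hM⟩ := B.bdd
    refine ⟨max N M, fun n hn => ?_⟩
    rw [hN n (lt_of_le_of_lt (le_max_left _ _) hn), hM n (lt_of_le_of_lt (le_max_right _ _) hn),
      add_zero]⟩⟩

instance : Neg (PDO R) :=
  ⟨fun A => ⟨fun n => -A.coeff n, by
    obtain ⟨N, hN⟩ := A.bdd
    exact ⟨N, fun n hn => by rw [hN n hn, neg_zero]⟩⟩⟩

instance : AddCommGroup (PDO R) where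
  add_assoc A B C := PDO.ext (funext fun n => add_assoc (A.coeff n) (B.coeff n) (C.coeff n))
  zero_add A := PDO.ext (funext fun n => zero_add (A.coeff n))
  add_zero A := PDO.ext (funext fun n => add_zero (A.coeff n))
  add_comm A B := PDO.ext (funext fun n => add_comm (A.coeff n) (B.coeff n))
  neg_add_cancel A := PDO.ext (funext fun n => neg_add_cancel (A.coeff n))
  nsmul := nsmulRec
  zsmul := zsmulRec

@[simp] theorem coeff_zero (n : ℤ) : (0 : PDO R).coeff n = 0 := rfl

@[simp] theorem coeff_add (A B : PDO R) (n : ℤ) :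
    (A + B).coeff n = A.coeff n + B.coeff n := rfl

@[simp] theorem coeff_neg (A : PDO R) (n : ℤ) : (-A).coeff n = -A.coeff n := rfl

@[simp] theorem coeff_sub (A B : PDO R) (n : ℤ) :
    (A - B).coeff n = A.coeff n - B.coeff n := by
  rw [sub_eq_add_neg, coeff_add, coeff_neg, ← sub_eq_add_neg]

/-- The operator `f Dⁿ`. -/
def monomial (n : ℤ) (f : R) : PDO R :=
  ⟨fun m => if m = n then f else 0, n, fun _ hm => if_neg (ne_of_gt hm)⟩

theorem coeff_monomial (n m : ℤ) (f : R) :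
    (monomial n f).coeff m = if m = n then f else 0 := rfl

theorem sum_range_shift (f : ℕ → R) (M d : ℕ) (h1 : ∀ e, e < d → f e = 0)
    (h2 : ∀ e, M ≤ e → f e = 0) :
    ∑ e ∈ Finset.range M, f e = ∑ q ∈ Finset.range M, f (q + d) := by
  have hA : ∑ e ∈ Finset.range M, f e = ∑ e ∈ Finset.range (d + M), f e := by
    refine Finset.sum_subset (Finset.range_subset_range.mpr (by omega)) fun e _ he => h2 e ?_
    simpa using he
  rw [hA, Finset.sum_range_add, Finset.sum_eq_zero (fun e he => h1 e (by simpa using he)), zero_add]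
  exact Finset.sum_congr rfl fun q _ => by rw [add_comm]

theorem sum_range_diag (f : ℕ → ℕ → R) (M : ℕ) (h : ∀ i j, M ≤ i + j → f i j = 0) :
    ∑ i ∈ Finset.range M, ∑ j ∈ Finset.range M, f i j =
      ∑ l ∈ Finset.range M, ∑ p ∈ Finset.HasAntidiagonal.antidiagonal l, f p.1 p.2 := by
  have h1 : ∀ l, ∑ p ∈ Finset.HasAntidiagonal.antidiagonal l, f p.1 p.2 =
      ∑ k ∈ Finset.range (l + 1), f k (l - k) := fun l =>
    Finset.Nat.sum_antidiagonal_eq_sum_range_succ f l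
  simp only [h1]
  rw [Finset.sum_range_diag_flip]
  refine Finset.sum_congr rfl fun i _ => ?_
  symm
  refine Finset.sum_subset (Finset.range_subset_range.mpr (by omega)) fun j _ hj => h i j ?_
  have : M - i ≤ j := by simpa using hj
  omega

end Additive

section Ring

variable {R : Type*} [CommRing R] [Differential R]

theorem dx_zero_right (j : ℕ) : dx j (0 : R) = 0 := by
  induction j with
  | zero => rfl
  | succ j ih => unfold dx at *; rw [Function.iterate_succ_apply', ih, map_zero]

theorem dx_add (j : ℕ) (f g : R) : dx j (f + g) = dx j f + dx j g := by
  induction j with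
  | zero => rfl
  | succ j ih => unfold dx at *; simp only [Function.iterate_succ_apply', ih, map_add]

theorem dx_sum {ι : Type*} (j : ℕ) (s : Finset ι) (f : ι → R) :
    dx j (∑ i ∈ s, f i) = ∑ i ∈ s, dx j (f i) :=
  map_sum (AddMonoidHom.mk' (dx j) (dx_add j)) f s

theorem dx_succ (j : ℕ) (f : R) : dx (j + 1) f = (dx j f)′ := by
  unfold dx; rw [Function.iterate_succ_apply']

theorem dx_succ_in (j : ℕ) (f : R) : dx (j + 1) f = dx j (f′) := rfl

theorem dx_dx (i j : ℕ) (f : R) : dx i (dx j f) = dx (i + j) f := by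
  unfold dx; rw [Function.iterate_add_apply]

theorem dx_zsmul (j : ℕ) (c : ℤ) (f : R) : dx j (c • f) = c • dx j f :=
  map_zsmul (AddMonoidHom.mk' (dx j) (dx_add j)) c f

theorem dx_mul (n : ℕ) (f g : R) :
    dx n (f * g) = ∑ j ∈ Finset.range (n + 1), n.choose j • (dx j f * dx (n - j) g) := by
  have key : ∀ n : ℕ, dx n (f * g) =
      ∑ p ∈ Finset.HasAntidiagonal.antidiagonal n, n.choose p.1 • (dx p.1 f * dx p.2 g) := by
    intro n
    induction n with
    | zero => simp [dx]
    | succ n ih =>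
      rw [dx_succ, ih, map_sum,
        Finset.sum_antidiagonal_choose_succ_nsmul (fun i j => dx i f * dx j g) n,
        ← Finset.sum_add_distrib]
      refine Finset.sum_congr rfl fun p hp => ?_
      have h2 : n.choose p.2 = n.choose p.1 :=
        (Nat.choose_symm_of_eq_add (Finset.HasAntidiagonal.mem_antidiagonal.mp hp).symm).symm
      rw [map_nsmul, Derivation.leibniz, dx_succ, dx_succ, h2, ← nsmul_add]
      simp only [smul_eq_mul]
      congr 1
      ring
  rw [key, Finset.Nat.sum_antidiagonal_eq_sum_range_succ
    (fun i j => n.choose i • (dx i f * dx j g))]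

/-- The contribution of `aᵢ Dⁱ` and of the `j`-th term of the Leibniz rule
`Dⁱ b = ∑ⱼ (i choose j) (∂ʲ b) Dⁱ⁻ʲ` to the coefficient of `Dˢ` in `A * B`, with `p = (i, j)`. -/
def mulTerm (A B : PDO R) (s : ℤ) (p : ℤ × ℕ) : R :=
  Ring.choose p.1 p.2 • (A.coeff p.1 * dx p.2 (B.coeff (s - p.1 + p.2)))

theorem mulTerm_eq_zero {A B : PDO R} {NA NB : ℤ} (hA : ∀ n, NA < n → A.coeff n = 0)
    (hB : ∀ n, NB < n → B.coeff n = 0) {s : ℤ} {p : ℤ × ℕ}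
    (h : NA < p.1 ∨ NB < s - p.1 + p.2) : mulTerm A B s p = 0 := by
  unfold mulTerm
  rcases h with h | h
  · rw [hA _ h, zero_mul, smul_zero]
  · rw [hB _ h, dx_zero_right, mul_zero, smul_zero]

theorem finsum_mulTerm {A B : PDO R} {NA NB : ℤ} (hA : ∀ n, NA < n → A.coeff n = 0)
    (hB : ∀ n, NB < n → B.coeff n = 0) (s : ℤ) (M : ℕ) (hM : NA + NB - s < M) :
    ∑ᶠ p : ℤ × ℕ, mulTerm A B s p =
      ∑ i ∈ Finset.range M, ∑ j ∈ Finset.range M, Ring.choose (NA - i) j •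
        (A.coeff (NA - i) * dx j (B.coeff (s - NA + i + j))) := by
  have hinj : Function.Injective (fun p : ℕ × ℕ => ((NA - p.1, p.2) : ℤ × ℕ)) := by
    rintro ⟨a, b⟩ ⟨c, d⟩ h
    simp only [Prod.mk.injEq] at h
    ext
    · show a = c
      omega
    · exact h.2
  rw [finsum_eq_sum_of_support_subset (s := (Finset.range M ×ˢ Finset.range M).map ⟨_, hinj⟩),
    Finset.sum_map, Finset.sum_product]
  · refine Finset.sum_congr rfl fun i _ => Finset.sum_congr rfl fun j _ => ?_
    simp only [mulTerm, Function.Embedding.coeFn_mk]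
    rw [show s - (NA - (i : ℤ)) + (j : ℤ) = s - NA + i + j by ring]
  · rintro ⟨i, j⟩ hp
    rw [Function.mem_support] at hp
    have h : ¬ (NA < i ∨ NB < s - i + j) := fun h => hp (mulTerm_eq_zero hA hB h)
    push Not at h
    simp only [Finset.coe_map, Set.mem_image, Finset.mem_coe, Finset.mem_product,
      Finset.mem_range, Function.Embedding.coeFn_mk, Prod.exists, Prod.mk.injEq]
    exact ⟨(NA - i).toNat, j, ⟨by omega, by omega⟩, by omega, rfl⟩

/-- The product of pseudo-differential operators, given by the generalized Leibniz rule
`Dⁱ b = ∑_{j ≥ 0} (i choose j) (∂ʲ b) Dⁱ⁻ʲ` for all integers `i`. -/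
noncomputable instance : Mul (PDO R) :=
  ⟨fun A B => ⟨fun s => ∑ᶠ p : ℤ × ℕ, mulTerm A B s p, by
    obtain ⟨NA, hA⟩ := A.bdd
    obtain ⟨NB, hB⟩ := B.bdd
    refine ⟨NA + NB, fun s hs => ?_⟩
    rw [finsum_mulTerm hA hB s 0 (by push_cast; omega), Finset.sum_range_zero]⟩⟩

theorem coeff_mul (A B : PDO R) (s : ℤ) :
    (A * B).coeff s = ∑ᶠ p : ℤ × ℕ, Ring.choose p.1 p.2 •
      (A.coeff p.1 * dx p.2 (B.coeff (s - p.1 + p.2))) := rfl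

theorem coeff_mul_eq_sum {A B : PDO R} {NA NB : ℤ} (hA : ∀ n, NA < n → A.coeff n = 0)
    (hB : ∀ n, NB < n → B.coeff n = 0) (s : ℤ) (M : ℕ) (hM : NA + NB - s < M) :
    (A * B).coeff s =
      ∑ i ∈ Finset.range M, ∑ j ∈ Finset.range M, Ring.choose (NA - i) j •
        (A.coeff (NA - i) * dx j (B.coeff (s - NA + i + j))) :=
  finsum_mulTerm hA hB s M hM

theorem coeff_mul_eq_zero {A B : PDO R} {NA NB : ℤ} (hA : ∀ n, NA < n → A.coeff n = 0)
    (hB : ∀ n, NB < n → B.coeff n = 0) (s : ℤ) (hs : NA + NB < s) : (A * B).coeff s = 0 := by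
  rw [coeff_mul_eq_sum hA hB s 0 (by push_cast; omega), Finset.sum_range_zero]

protected theorem mul_assoc' (A B C : PDO R) : A * B * C = A * (B * C) := by
  obtain ⟨NA, hA⟩ := A.bdd
  obtain ⟨NB, hB⟩ := B.bdd
  obtain ⟨NC, hC⟩ := C.bdd
  ext s
  obtain ⟨M, hM⟩ : ∃ M : ℕ, NA + NB + NC - s < M := ⟨(NA + NB + NC - s).toNat + 1, by omega⟩
  have hAB : ∀ n, NA + NB < n → (A * B).coeff n = 0 := fun n hn => coeff_mul_eq_zero hA hB n hn
  have hBC : ∀ n, NB + NC < n → (B * C).coeff n = 0 := fun n hn => coeff_mul_eq_zero hB hC n hn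
  have hL : (A * B * C).coeff s = ∑ p ∈ Finset.range M, ∑ q ∈ Finset.range M,
      ∑ j ∈ Finset.range M, ∑ l ∈ Finset.range M,
        (Ring.choose (NA - p) j * Ring.choose (NA - p + (NB - q) - j) l) •
          (A.coeff (NA - p) * dx j (B.coeff (NB - q)) *
            dx l (C.coeff (s - NA - NB + p + q + j + l))) := by
    rw [coeff_mul_eq_sum hAB hC s M (by omega)]
    have h1 : ∀ e ∈ Finset.range M, ∀ l ∈ Finset.range M,
        Ring.choose (NA + NB - (e : ℤ)) l • ((A * B).coeff (NA + NB - e) *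
          dx l (C.coeff (s - (NA + NB) + e + l))) =
        ∑ p ∈ Finset.range M, ∑ j ∈ Finset.range M,
          (Ring.choose (NA - p) j * Ring.choose (NA + NB - (e : ℤ)) l) •
            (A.coeff (NA - p) * dx j (B.coeff (NB - e + p + j)) *
              dx l (C.coeff (s - (NA + NB) + e + l))) := by
      intro e he l _
      have he' : e < M := by simpa using he
      rw [coeff_mul_eq_sum hA hB _ M (by omega)]
      simp only [Finset.sum_mul, Finset.smul_sum]
      refine Finset.sum_congr rfl fun p _ => Finset.sum_congr rfl fun j _ => ?_
      rw [show NA + NB - (e : ℤ) - NA + p + j = NB - e + p + j by ring, smul_mul_assoc, smul_smul,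
        mul_comm (Ring.choose (NA + NB - (e : ℤ)) l)]
    rw [Finset.sum_congr rfl fun e he => Finset.sum_congr rfl fun l hl => h1 e he l hl,
      Finset.sum_congr rfl fun e _ => Finset.sum_comm, Finset.sum_comm]
    refine Finset.sum_congr rfl fun p _ => ?_
    rw [Finset.sum_congr rfl fun e _ => Finset.sum_comm, Finset.sum_comm,
      Finset.sum_comm (s := Finset.range M) (t := Finset.range M)
        (f := fun q j => ∑ l ∈ Finset.range M,
          (Ring.choose (NA - p) j * Ring.choose (NA - p + (NB - q) - j) l) •
          (A.coeff (NA - p) * dx j (B.coeff (NB - q)) *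
            dx l (C.coeff (s - NA - NB + p + q + j + l))))]
    refine Finset.sum_congr rfl fun j _ => ?_
    rw [Finset.sum_comm, Finset.sum_comm (s := Finset.range M) (t := Finset.range M)
        (f := fun q l =>
          (Ring.choose (NA - p) j * Ring.choose (NA - p + (NB - q) - j) l) •
          (A.coeff (NA - p) * dx j (B.coeff (NB - q)) *
            dx l (C.coeff (s - NA - NB + p + q + j + l))))]
    refine Finset.sum_congr rfl fun l _ => ?_
    rw [sum_range_shift _ M (p + j)]
    · refine Finset.sum_congr rfl fun q _ => ?_
      push_cast
      rw [show NA + NB - ((q : ℤ) + (p + j)) = NA - p + (NB - q) - j by ring,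
        show NB - ((q : ℤ) + (p + j)) + p + j = NB - q by ring,
        show s - (NA + NB) + ((q : ℤ) + (p + j)) + l = s - NA - NB + p + q + j + l by ring]
    · intro e he
      rw [hB _ (by omega), dx_zero_right, mul_zero, zero_mul, smul_zero]
    · intro e he
      rw [hC _ (by omega), dx_zero_right, mul_zero, smul_zero]
  rw [hL, coeff_mul_eq_sum hA hBC s M (by omega)]
  refine Finset.sum_congr rfl fun p _ => ?_
  have h1 : ∀ P ∈ Finset.range M,
      Ring.choose (NA - (p : ℤ)) P • (A.coeff (NA - p) *
        dx P ((B * C).coeff (s - NA + p + P))) =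
      ∑ q ∈ Finset.range M, ∑ Q ∈ Finset.range M, ∑ j ∈ Finset.range M,
        (Ring.choose (NA - (p : ℤ)) P * (P.choose j : ℤ) * Ring.choose (NB - (q : ℤ)) Q) •
          (A.coeff (NA - p) * dx j (B.coeff (NB - q)) *
            dx (P - j + Q) (C.coeff (s - NA - NB + p + q + P + Q))) := by
    intro P hP
    have hP' : P < M := by simpa using hP
    rw [coeff_mul_eq_sum hB hC _ M (by omega), dx_sum, Finset.mul_sum, Finset.smul_sum]
    refine Finset.sum_congr rfl fun q _ => ?_
    rw [dx_sum, Finset.mul_sum, Finset.smul_sum]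
    refine Finset.sum_congr rfl fun Q _ => ?_
    rw [dx_zsmul, dx_mul]
    have hsub : Finset.range (P + 1) ⊆ Finset.range M := Finset.range_subset_range.mpr hP'
    rw [← Finset.sum_subset hsub]
    · simp only [Finset.smul_sum, Finset.mul_sum]
      refine Finset.sum_congr rfl fun j _ => ?_
      rw [dx_dx, show s - NA + (p : ℤ) + P - NB + q + Q = s - NA - NB + p + q + P + Q by ring]
      simp only [zsmul_eq_mul, nsmul_eq_mul]
      push_cast
      ring
    · intro j _ hj
      have hj' : P < j := by simpa using hj
      rw [Nat.choose_eq_zero_of_lt hj']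
      simp
  symm
  rw [Finset.sum_congr rfl h1, Finset.sum_comm]
  refine Finset.sum_congr rfl fun q _ => ?_
  rw [Finset.sum_congr rfl fun P _ => Finset.sum_comm, Finset.sum_comm]
  refine Finset.sum_congr rfl fun j _ => ?_
  rw [Finset.sum_comm, Finset.sum_congr rfl fun Q _ => sum_range_shift _ M j ?_ ?_, Finset.sum_comm,
    sum_range_diag]
  · refine Finset.sum_congr rfl fun l _ => ?_
    have h2 : ∀ x ∈ Finset.HasAntidiagonal.antidiagonal l,
        (Ring.choose (NA - (p : ℤ)) (x.1 + j) * (((x.1 + j).choose j : ℕ) : ℤ) *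
          Ring.choose (NB - (q : ℤ)) x.2) •
          (A.coeff (NA - p) * dx j (B.coeff (NB - q)) *
            dx (x.1 + j - j + x.2) (C.coeff (s - NA - NB + p + q + ((x.1 + j : ℕ) : ℤ) + x.2))) =
        (Ring.choose (NA - (p : ℤ)) j * (Ring.choose (NA - (p : ℤ) - j) x.1 *
          Ring.choose (NB - (q : ℤ)) x.2)) •
          (A.coeff (NA - p) * dx j (B.coeff (NB - q)) *
            dx l (C.coeff (s - NA - NB + p + q + j + l))) := by
      intro x hx
      have hx' : x.1 + x.2 = l := Finset.HasAntidiagonal.mem_antidiagonal.mp hx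
      have hc := Ring.choose_smul_choose (NA - (p : ℤ)) (Nat.le_add_left j x.1)
      rw [Nat.add_sub_cancel, nsmul_eq_mul] at hc
      rw [Nat.add_sub_cancel, hx', ← mul_assoc, ← hc]
      rw [show s - NA - NB + (p : ℤ) + q + ((x.1 + j : ℕ) : ℤ) + x.2
        = s - NA - NB + p + q + j + l by rw [← hx']; push_cast; ring]
      congr 1
      ring
    rw [Finset.sum_congr rfl h2, ← Finset.sum_smul, ← Finset.mul_sum,
      ← Ring.add_choose_eq l (Commute.all _ _),
      show NA - (p : ℤ) - j + (NB - q) = NA - p + (NB - q) - j by ring]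
  · intro x y hxy
    rw [hC _ (by push_cast; omega), dx_zero_right, mul_zero, smul_zero]
  · intro P hP
    rw [Nat.choose_eq_zero_of_lt hP]
    simp
  · intro P hP
    rw [hC _ (by omega), dx_zero_right, mul_zero, smul_zero]

noncomputable instance : One (PDO R) := ⟨monomial 0 1⟩

theorem coeff_zero_monomial_mul (f : R) (A : PDO R) (s : ℤ) :
    (monomial 0 f * A).coeff s = f * A.coeff s := by
  rw [coeff_mul, finsum_eq_single _ ((0, 0) : ℤ × ℕ)]
  · simp [coeff_monomial, dx]
  · rintro ⟨i, j⟩ h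
    by_cases hi : i = 0
    · subst hi
      have hj : j ≠ 0 := fun hj => h (by rw [hj])
      rw [Ring.choose_zero_pos ℤ (Nat.pos_of_ne_zero hj), zero_smul]
    · rw [coeff_monomial, if_neg hi, zero_mul, smul_zero]

theorem dx_one (j : ℕ) : dx (j + 1) (1 : R) = 0 := by
  rw [dx_succ_in, Derivation.map_one_eq_zero, dx_zero_right]

theorem coeff_mul_monomial_one (A : PDO R) (n s : ℤ) :
    (A * monomial n 1).coeff s = A.coeff (s - n) := by
  rw [coeff_mul, finsum_eq_single _ ((s - n, 0) : ℤ × ℕ)]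
  · simp [coeff_monomial, dx]
  · rintro ⟨i, j⟩ h
    rw [coeff_monomial]
    dsimp only
    split_ifs with hi
    · cases j with
      | zero => exact absurd (by ext <;> simp; push_cast at hi; omega) h
      | succ j => rw [dx_one, mul_zero, smul_zero]
    · rw [dx_zero_right, mul_zero, smul_zero]

noncomputable instance : Ring (PDO R) :=
  { (inferInstance : AddCommGroup (PDO R)) with
    mul_assoc := PDO.mul_assoc'
    one_mul A := by
      ext s
      exact (coeff_zero_monomial_mul 1 A s).trans (one_mul _)
    mul_one A := by
      ext s
      exact (coeff_mul_monomial_one A 0 s).trans (by rw [sub_zero])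
    zero_mul A := by
      ext s
      rw [coeff_mul]
      simp
    mul_zero A := by
      ext s
      rw [coeff_mul]
      simp [dx_zero_right]
    left_distrib A B C := by
      obtain ⟨NA, hA⟩ := A.bdd
      obtain ⟨NB, hB⟩ := B.bdd
      obtain ⟨NC, hC⟩ := C.bdd
      have hB' : ∀ n, max NB NC < n → B.coeff n = 0 := fun n hn => hB n (by omega)
      have hC' : ∀ n, max NB NC < n → C.coeff n = 0 := fun n hn => hC n (by omega)
      have hS : ∀ n, max NB NC < n → (B + C).coeff n = 0 := fun n hn => by
        rw [coeff_add, hB' n hn, hC' n hn, add_zero]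
      ext s
      obtain ⟨M, hM⟩ : ∃ M : ℕ, NA + max NB NC - s < M :=
        ⟨(NA + max NB NC - s).toNat + 1, by omega⟩
      rw [coeff_add, coeff_mul_eq_sum hA hS s M hM, coeff_mul_eq_sum hA hB' s M hM,
        coeff_mul_eq_sum hA hC' s M hM]
      simp only [coeff_add, dx_add, mul_add, smul_add, Finset.sum_add_distrib]
    right_distrib A B C := by
      obtain ⟨NA, hA⟩ := A.bdd
      obtain ⟨NB, hB⟩ := B.bdd
      obtain ⟨NC, hC⟩ := C.bdd
      have hA' : ∀ n, max NA NB < n → A.coeff n = 0 := fun n hn => hA n (by omega)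
      have hB' : ∀ n, max NA NB < n → B.coeff n = 0 := fun n hn => hB n (by omega)
      have hS : ∀ n, max NA NB < n → (A + B).coeff n = 0 := fun n hn => by
        rw [coeff_add, hA' n hn, hB' n hn, add_zero]
      ext s
      obtain ⟨M, hM⟩ : ∃ M : ℕ, max NA NB + NC - s < M :=
        ⟨(max NA NB + NC - s).toNat + 1, by omega⟩
      rw [coeff_add, coeff_mul_eq_sum hS hC s M hM, coeff_mul_eq_sum hA' hC s M hM,
        coeff_mul_eq_sum hB' hC s M hM]
      simp only [coeff_add, add_mul, smul_add, Finset.sum_add_distrib] }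


/-- The multiplication operator by the function `f`. -/
def ofFun (f : R) : PDO R := monomial 0 f

/-- The operator `Dⁿ`, for an integer `n`. -/
def D (n : ℤ) : PDO R := monomial n 1

theorem ofFun_mul_ofFun (f g : R) : ofFun f * ofFun g = ofFun (f * g) := by
  ext s
  simp only [ofFun, coeff_zero_monomial_mul, coeff_monomial, mul_ite, mul_zero]

theorem ofFun_one : ofFun (1 : R) = 1 := rfl

theorem D_mul_D (m n : ℤ) : D m * D n = (D (m + n) : PDO R) := by
  ext s
  simp only [D, coeff_mul_monomial_one, coeff_monomial, sub_eq_iff_eq_add]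

theorem D_zero : D 0 = (1 : PDO R) := rfl

/-- The operator `Dⁿ` as an invertible operator. -/
noncomputable def DUnit (n : ℤ) : (PDO R)ˣ where
  val := D n
  inv := D (-n)
  val_inv := by rw [D_mul_D, add_neg_cancel, D_zero]
  inv_val := by rw [D_mul_D, neg_add_cancel, D_zero]

/-- The multiplication operator by an invertible function, as an invertible operator. -/
noncomputable def ofUnit (u : Rˣ) : (PDO R)ˣ where
  val := ofFun (u : R)
  inv := ofFun ((u⁻¹ : Rˣ) : R)
  val_inv := by rw [ofFun_mul_ofFun, Units.mul_inv, ofFun_one]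
  inv_val := by rw [ofFun_mul_ofFun, Units.inv_mul, ofFun_one]

/-- The operator `f D⁻¹ g`. -/
noncomputable def fDinvg (f g : R) : PDO R := ofFun f * D (-1) * ofFun g

/-- The purely pseudo-differential part `A₋ = ∑_{n < 0} aₙ Dⁿ`. -/
def neg (A : PDO R) : PDO R :=
  ⟨fun n => if n < 0 then A.coeff n else 0, 0, fun _ hn => if_neg (by omega)⟩

/-- The function `A₊(f)`: the action on `f` of the differential part `A₊ = ∑_{n ≥ 0} aₙ Dⁿ`. -/
noncomputable def posApply (A : PDO R) (f : R) : R := ∑ᶠ n : ℕ, A.coeff n * dx n f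

/-- The function `(A₊)*(g) = ∑_{n ≥ 0} (-∂)ⁿ (aₙ g)`: the action on `g` of the formal adjoint of
the differential part of `A`. -/
noncomputable def posAdjApply (A : PDO R) (g : R) : R :=
  ∑ᶠ n : ℕ, (-1) ^ n * dx n (A.coeff n * g)

/-- The boundary term `B(f, g)` of the repeated integration by parts which moves the differential
part of `A` from `f` to `g`: it satisfies `∂ B(f, g) = A₊(f) g - f (A₊)*(g)`. -/
noncomputable def boundary (A : PDO R) (f g : R) : R :=
  ∑ᶠ n : ℕ, ∑ m ∈ Finset.range n, (-1) ^ m * (dx (n - 1 - m) f * dx m (A.coeff n * g))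

/-- A derivation of the coefficients acting on operators, coefficient by coefficient. -/
def mapDer (δ : Derivation ℤ R R) (A : PDO R) : PDO R :=
  ⟨fun n => δ (A.coeff n), by
    obtain ⟨N, hN⟩ := A.bdd
    exact ⟨N, fun n hn => by rw [hN n hn, map_zero]⟩⟩

/-- The purely pseudo-differential part of the formal series of operators `∑_l A_l`, summed
coefficient by coefficient. -/
noncomputable def negSum [TopologicalSpace R] (A : ℕ → PDO R) : PDO R :=
  ⟨fun n => if n < 0 then ∑' l, (A l).coeff n else 0, 0, fun _ hn => if_neg (by omega)⟩

/-- The Darboux-Bäcklund operator `T = Φ D Φ⁻¹`, for an invertible function `Φ`. -/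
noncomputable def darboux (Φ : Rˣ) : (PDO R)ˣ := ofUnit Φ * DUnit 1 * (ofUnit Φ)⁻¹

/-- The function `T(f) = Φ ∂(Φ⁻¹ f)`. -/
def darbouxApply (Φ : Rˣ) (f : R) : R := Φ * (((Φ⁻¹ : Rˣ) : R) * f)′

end Ring

end PDO

/-- The times `t₁ = x, t₂, t₃, …` and the commuting derivations `∂/∂tₙ` on the ring of functions;
only indices `n ≥ 1` are meaningful. -/
structure KPTimes (R : Type*) [CommRing R] [Differential R] where
  flow : ℕ → Derivation ℤ R R
  t : ℕ → R
  flow_one : flow 1 = Differential.deriv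
  flow_comm : ∀ m n, 1 ≤ m → 1 ≤ n → ∀ f, flow m (flow n f) = flow n (flow m f)
  flow_t : ∀ m n, 1 ≤ m → 1 ≤ n → flow m (t n) = if m = n then 1 else 0

/-- A dressing operator `W` together with the functions `Φ`, `Ψ`. -/
structure LaxSystem (R : Type*) [CommRing R] [Differential R] where
  W : (PDO R)ˣ
  Φ : R
  Ψ : R

namespace LaxSystem

variable {R : Type*} [CommRing R] [Differential R]

/-- `W Dˡ W⁻¹`, that is, the power `L^{l/r}` of the Lax operator `L = W Dʳ W⁻¹`. -/
noncomputable def root (S : LaxSystem R) (l : ℕ) : PDO R :=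
  (S.W : PDO R) * PDO.D (l : ℤ) * ((S.W⁻¹ : (PDO R)ˣ) : PDO R)

/-- The Lax operator `L = W Dʳ W⁻¹`. -/
noncomputable def lax (S : LaxSystem R) (r : ℕ) : PDO R := S.root r

/-- The constrained KP hierarchy `cKP_{r,1}`: `W = 1 + ∑_{n ≥ 1} wₙ D⁻ⁿ` solves the Wilson-Sato
equations `∂W/∂tₙ = -(L^{n/r})₋ W`, the Lax operator has the form `L = L₊ + Φ D⁻¹ Ψ`, and `Φ`, `Ψ`
are an eigenfunction and an adjoint eigenfunction of `L`. -/
structure IsCKP (T : KPTimes R) (r : ℕ) (S : LaxSystem R) : Prop where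
  coeff_zero : (S.W : PDO R).coeff 0 = 1
  coeff_pos : ∀ n, 0 < n → (S.W : PDO R).coeff n = 0
  sato : ∀ n, 1 ≤ n → PDO.mapDer (T.flow n) (S.W : PDO R) = -((S.root n).neg * (S.W : PDO R))
  constraint : (S.lax r).neg = PDO.fDinvg S.Φ S.Ψ
  eigen : ∀ n, 1 ≤ n → T.flow n S.Φ = (S.root n).posApply S.Φ
  adjoint : ∀ n, 1 ≤ n → T.flow n S.Ψ = -(S.root n).posAdjApply S.Ψ

/-- The terms `M_l` of the formal series `M = ∑_l M_l = W (∑_{l ≥ 1} (l/r) t_l D^{l-r} + E) W⁻¹`: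
the term with index `0` is `W E W⁻¹`, the term with index `l ≥ 1` is
`W ((l/r) t_l D^{l-r}) W⁻¹`. -/
noncomputable def orlov [Algebra ℚ R] (T : KPTimes R) (r : ℕ) (S : LaxSystem R) (E : PDO R) :
    ℕ → PDO R
  | 0 => (S.W : PDO R) * E * ((S.W⁻¹ : (PDO R)ˣ) : PDO R)
  | l + 1 => (S.W : PDO R) *
      PDO.monomial (((l + 1 : ℕ) : ℤ) - r) ((((l + 1 : ℕ) : ℚ) / r) • T.t (l + 1)) *
        ((S.W⁻¹ : (PDO R)ˣ) : PDO R)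

end LaxSystem

/-- The functions `φ n = Lⁿ(Φ)`, `ψ n = (L*)ⁿ(Ψ)` and `Ω i j = ∂⁻¹(Lⁱ(Φ) (L*)ʲ(Ψ))`. -/
structure Iterates (R : Type*) where
  φ : ℕ → R
  ψ : ℕ → R
  Ω : ℕ → ℕ → R

namespace Iterates

variable {R : Type*} [CommRing R] [Differential R]

/-- The iterated actions of `L = L₊ + Φ D⁻¹ Ψ` on `Φ` and of `L*` on `Ψ`, where
`L(f) = L₊(f) + Φ ∂⁻¹(Ψ f)` and `L*(g) = (L₊)*(g) - Ψ ∂⁻¹(Φ g)`. The integration constants of the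
functions `Ω i j = ∂⁻¹(φᵢ ψⱼ)` obey integration by parts, `parts`; this relation
holds automatically after differentiation, so that it only fixes constants. -/
structure IsFor (L : PDO R) (Φ Ψ : R) (P : Iterates R) : Prop where
  φ_zero : P.φ 0 = Φ
  ψ_zero : P.ψ 0 = Ψ
  φ_succ : ∀ i, P.φ (i + 1) = L.posApply (P.φ i) + Φ * P.Ω i 0
  ψ_succ : ∀ j, P.ψ (j + 1) = L.posAdjApply (P.ψ j) - Ψ * P.Ω 0 j
  deriv_Ω : ∀ i j, (P.Ω i j)′ = P.φ i * P.ψ j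
  parts : ∀ i j, P.Ω (i + 1) j - P.Ω i (j + 1) =
    L.boundary (P.φ i) (P.ψ j) + P.Ω i 0 * P.Ω 0 j

/-- The operator `X⁽¹⁾_K = ∑_{j=0}^{K-1} (j - (K-1)/2) L^{K-1-j}(Φ) D⁻¹ (L*)ʲ(Ψ)`
(for `K = 0` it is zero). -/
noncomputable def X [Algebra ℚ R] (P : Iterates R) (K : ℕ) : PDO R :=
  ∑ j ∈ Finset.range K, PDO.ofFun (algebraMap ℚ R ((j : ℚ) - ((K : ℚ) - 1) / 2)) *
    PDO.fDinvg (P.φ (K - 1 - j)) (P.ψ j)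

/-- The iterated actions after the Darboux-Bäcklund transformation:
`L̃ⁿ(Φ̃) = T(Lⁿ⁺¹(Φ))`, `Ψ̃ = Φ⁻¹`, `(L̃*)ʲ⁺¹(Ψ̃) = (T⁻¹)*((L*)ʲ(Ψ)) = -Φ⁻¹ ∂⁻¹(Φ (L*)ʲ(Ψ))`. -/
def darboux (P : Iterates R) (Φ : Rˣ) : Iterates R where
  φ n := PDO.darbouxApply Φ (P.φ (n + 1))
  ψ
    | 0 => ((Φ⁻¹ : Rˣ) : R)
    | j + 1 => -(((Φ⁻¹ : Rˣ) : R) * P.Ω 0 j)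
  Ω
    | i, 0 => ((Φ⁻¹ : Rˣ) : R) * P.φ (i + 1)
    | i, j + 1 => P.Ω (i + 1) j - ((Φ⁻¹ : Rˣ) : R) * P.φ (i + 1) * P.Ω 0 j

end Iterates

/-- The Darboux-Bäcklund transform: `W̃ = T W D⁻¹`, `Φ̃ = T(L(Φ))`, `Ψ̃ = Φ⁻¹`, with
`T = Φ D Φ⁻¹`; here `P` provides the function `L(Φ)`. -/
noncomputable def LaxSystem.darboux {R : Type*} [CommRing R] [Differential R] (S : LaxSystem R)
    (Φ : Rˣ) (P : Iterates R) : LaxSystem R where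
  W := PDO.darboux Φ * S.W * PDO.DUnit (-1)
  Φ := PDO.darbouxApply Φ (P.φ 1)
  Ψ := ((Φ⁻¹ : Rˣ) : R)

/-- The right-hand side `[-(M Lᵏ)₋ + X⁽¹⁾_{k-1}, L]` of the modified additional-symmetry flow
(`X⁽¹⁾_{k-1} = 0` for `k = 0`), where `M = ∑_l M_l` is a formal series of operators. -/
noncomputable def additionalFlow {R : Type*} [CommRing R] [Algebra ℚ R] [Differential R]
    [TopologicalSpace R] (L : PDO R) (M : ℕ → PDO R) (P : Iterates R) (k : ℕ) : PDO R :=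
  ⁅-PDO.negSum (fun l => M l * L ^ k) + P.X (k - 1), L⁆

/-- The isospectral derivative `∂A/∂t_{r(k-1)}`, understood as zero for `k = 0` and `k = 1`. -/
noncomputable def isospectral {R : Type*} [CommRing R] [Differential R] (T : KPTimes R)
    (r k : ℕ) (A : PDO R) : PDO R :=
  if 2 ≤ k then PDO.mapDer (T.flow (r * (k - 1))) A else 0

/-! Write A = M Lᵏ, K = k - 1 and δ = ∂*_k. Since δT = -T(δΦ) D⁻¹ Φ⁻¹ · T (`mapDer_darboux`),
differentiating L̃ = T L T⁻¹ gives (`mapDer_conj`) δL̃ = [T(-A₋ + X_K)T⁻¹ - T(δΦ) D⁻¹ Φ⁻¹, L̃]. Two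
comparisons move everything to the transformed side: (T A T⁻¹)₋ = T A₋ T⁻¹ + T(A₊(Φ)) D⁻¹ Φ⁻¹
(`neg_darboux_conj`), and X̃_K = T X_K T⁻¹ + (L̃ᴷ)₋ - T(`varΦ` K) D⁻¹ Φ⁻¹ (`X_darboux`). Once T(δΦ)
= T(A₊(Φ)) + T(`varΦ` K) is known, all terms ending in D⁻¹ Φ⁻¹ cancel and only -[(L̃ᴷ)₋, L̃] is
left, which is the isospectral flow.

The flow is prescribed on L alone, so it fixes δΦ only up to a constant multiple of Φ; T kills
exactly this ambiguity. A variation x D⁻¹ Ψ - Φ D⁻¹ y of Φ D⁻¹ Ψ determines (Φ⁻¹x)′ through its two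
leading coefficients (`logVar_fDinvg`). By `orlov_lie` the commutators [M_l Lᵏ, L] add up to -Lᵏ, so
-[A₋, L] can be traded for [A₊, L] + Lᵏ, which contributes A₊(Φ); by `neg_lie_X` the term X_K
contributes `varΦ` K and cancels Lᵏ. The series of the (M_l Lᵏ)₊(Φ) is not known to converge. Its
image under T does, because `logVar` is additive and continuous on coefficients, and this also gives
the convergence of (M̃ L̃ᵏ)₋.

The conditions on the iterates, including the one on integration constants, say precisely what the
purely pseudo-differential parts of L φᵢ D⁻¹, D⁻¹ ψⱼ L and D⁻¹ ψⱼ L φᵢ D⁻¹ are (`isFor_of_neg`).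
Hence their transformation reduces to associativity (`IsFor.darboux`).

For another choice of constants, the generating series of the φᵢ and ψⱼ are multiplied by series a,
b with constant coefficients, and the condition on the constants forces ab = 1
(`IsFor.exists_gauge`). The weights in X come from the Euler derivation z d/dz, so X changes by
constant multiples of the (Lʲ)₋ (`exists_X_eq`), that is, the flow changes by isospectral flows. -/

set_option linter.unusedSectionVars false

/-! ### Actions on functions as coefficients of operator products -/

namespace PDO

variable {R : Type*} [CommRing R] [Differential R]

theorem coeff_ofFun_mul (f : R) (A : PDO R) (s : ℤ) : (ofFun f * A).coeff s = f * A.coeff s :=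
  coeff_zero_monomial_mul f A s

theorem coeff_mul_D (A : PDO R) (n s : ℤ) : (A * D n).coeff s = A.coeff (s - n) :=
  coeff_mul_monomial_one A n s

theorem coeff_D (n m : ℤ) : (D n : PDO R).coeff m = if m = n then 1 else 0 := rfl

theorem coeff_ofFun (f : R) (m : ℤ) : (ofFun f).coeff m = if m = 0 then f else 0 := rfl

theorem monomial_eq (n : ℤ) (f : R) : monomial n f = ofFun f * D n := by
  ext s
  rw [coeff_ofFun_mul, coeff_D, coeff_monomial]
  simp

theorem coeff_D_mul (A : PDO R) (m s : ℤ) (M : ℕ)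
    (hM : ∀ n, s - m + M ≤ n → A.coeff n = 0) :
    (D m * A).coeff s =
      ∑ j ∈ Finset.range M, Ring.choose m j • dx j (A.coeff (s - m + j)) := by
  have hinj : Function.Injective (fun j : ℕ => ((m, j) : ℤ × ℕ)) := fun a b h => by
    simpa using h
  rw [coeff_mul, finsum_eq_sum_of_support_subset (s := (Finset.range M).map ⟨_, hinj⟩),
    Finset.sum_map]
  · refine Finset.sum_congr rfl fun j _ => ?_
    simp [coeff_D]
  · rintro ⟨i, j⟩ hp
    rw [Function.mem_support] at hp
    have hi : i = m := by
      by_contra hi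
      exact hp (by simp only [coeff_D, if_neg hi, zero_mul, smul_zero])
    subst hi
    have hj : j < M := by
      by_contra hj
      exact hp (by
        dsimp only
        rw [hM _ (by omega), dx_zero_right, mul_zero, smul_zero])
    simpa using hj

theorem coeff_mul_ofFun (A : PDO R) (f : R) (s : ℤ) (M : ℕ)
    (hM : ∀ n, s + M ≤ n → A.coeff n = 0) :
    (A * ofFun f).coeff s =
      ∑ j ∈ Finset.range M, Ring.choose (s + j) j • (A.coeff (s + j) * dx j f) := by
  have hinj : Function.Injective (fun j : ℕ => ((s + j, j) : ℤ × ℕ)) := fun a b h => by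
    simp only [Prod.mk.injEq] at h
    exact h.2
  rw [coeff_mul, finsum_eq_sum_of_support_subset (s := (Finset.range M).map ⟨_, hinj⟩),
    Finset.sum_map]
  · refine Finset.sum_congr rfl fun j _ => ?_
    simp [coeff_ofFun]
  · rintro ⟨i, j⟩ hp
    rw [Function.mem_support] at hp
    have hi : i = s + j := by
      by_contra hi
      exact hp (by
        dsimp only
        rw [coeff_ofFun, if_neg (by omega), dx_zero_right, mul_zero, smul_zero])
    subst hi
    have hj : j < M := by
      by_contra hj
      exact hp (by
        dsimp only
        rw [hM _ (by omega), zero_mul, smul_zero])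
    simpa using hj

theorem exists_bound (A : PDO R) (s : ℤ) : ∃ M : ℕ, ∀ n, s + M ≤ n → A.coeff n = 0 := by
  obtain ⟨N, hN⟩ := A.bdd
  exact ⟨(N + 1 - s).toNat, fun n hn => hN n (by omega)⟩

theorem choose_neg_one (j : ℕ) : Ring.choose (-1 : ℤ) j = (-1) ^ j := by
  rw [Ring.choose_neg', Ring.multichoose_one]
  simp [Int.negOnePow, Units.smul_def]

theorem coeff_D_neg_one_mul (A : PDO R) (s : ℤ) (M : ℕ)
    (hM : ∀ n, s + 1 + M ≤ n → A.coeff n = 0) :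
    (D (-1) * A).coeff s =
      ∑ j ∈ Finset.range M, (-1) ^ j * dx j (A.coeff (s + 1 + j)) := by
  rw [coeff_D_mul A (-1) s M (fun n hn => hM n (by omega))]
  refine Finset.sum_congr rfl fun j _ => ?_
  rw [choose_neg_one, sub_neg_eq_add, zsmul_eq_mul]
  push_cast
  rfl

/-- In aⱼ Dʲ f the order zero is reached only when all j derivatives hit f, with binomial
coefficient 1; negative orders never reach it. In this form the action inherits associativity from
the operator ring. -/
theorem posApply_eq_coeff (A : PDO R) (f : R) : A.posApply f = (A * ofFun f).coeff 0 := by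
  obtain ⟨M, hM⟩ := A.exists_bound 0
  rw [coeff_mul_ofFun A f 0 M hM, posApply,
    finsum_eq_sum_of_support_subset (s := Finset.range M)]
  · refine Finset.sum_congr rfl fun j _ => ?_
    rw [zero_add, Ring.choose_natCast, Nat.choose_self]
    simp
  · intro j hj
    by_contra h
    exact hj (by dsimp only; rw [hM _ (by simpa using h), zero_mul])

/-- D⁻¹ b = ∑ⱼ (-1)ʲ b⁽ʲ⁾ D⁻¹⁻ʲ, so the residue of D⁻¹ g aₙ Dⁿ is (-∂)ⁿ(g aₙ) for n ≥ 0 and zero for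
n < 0. -/
theorem posAdjApply_eq_coeff (A : PDO R) (g : R) :
    A.posAdjApply g = (D (-1) * ofFun g * A).coeff (-1) := by
  obtain ⟨M, hM⟩ := A.exists_bound 0
  rw [mul_assoc, coeff_D_neg_one_mul _ _ M, posAdjApply,
    finsum_eq_sum_of_support_subset (s := Finset.range M)]
  · refine Finset.sum_congr rfl fun j _ => ?_
    rw [coeff_ofFun_mul, mul_comm g]
    simp
  · intro j hj
    by_contra h
    exact hj (by dsimp only; rw [hM _ (by simpa using h), zero_mul, dx_zero_right, mul_zero])
  · intro n hn
    rw [coeff_ofFun_mul, hM _ (by omega), mul_zero]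

theorem boundary_eq_coeff (A : PDO R) (f g : R) :
    A.boundary f g = (D (-1) * ofFun g * A * ofFun f).coeff 0 := by
  obtain ⟨M, hM⟩ := A.exists_bound 0
  have hgA : ∀ n : ℤ, 0 + M ≤ n → (ofFun g * A).coeff n = 0 := fun n hn => by
    rw [coeff_ofFun_mul, hM _ hn, mul_zero]
  have hD : ∀ s : ℤ, 0 ≤ s → (D (-1) * (ofFun g * A)).coeff s =
      ∑ j ∈ Finset.range M, (-1) ^ j * dx j ((ofFun g * A).coeff (s + 1 + j)) := fun s hs =>
    coeff_D_neg_one_mul _ _ M (fun n hn => hgA n (by omega))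
  rw [mul_assoc (D (-1)), coeff_mul_ofFun _ f 0 M, boundary,
    finsum_eq_sum_of_support_subset (s := Finset.range (M + 1))]
  -- The summand n = 0 of the boundary term is empty. After removing it, order l + 1 of A matches
  -- the pairs of derivative counts with total l.
  · rw [Finset.sum_range_succ', Finset.range_zero, Finset.sum_empty, add_zero]
    have h1 : ∀ n ∈ Finset.range M, Ring.choose (0 + (n : ℤ)) n •
        ((D (-1) * (ofFun g * A)).coeff (0 + n) * dx n f) = ∑ j ∈ Finset.range M,
          (-1) ^ j * (dx n f * dx j (A.coeff ((n + j + 1 : ℕ) : ℤ) * g)) := by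
      intro n _
      rw [hD _ (by omega), zero_add, Ring.choose_natCast, Nat.choose_self, Nat.cast_one, one_smul,
        Finset.sum_mul]
      refine Finset.sum_congr rfl fun j _ => ?_
      rw [coeff_ofFun_mul, show (n : ℤ) + 1 + j = ((n + j + 1 : ℕ) : ℤ) by push_cast; ring,
        mul_comm g]
      ring
    rw [Finset.sum_congr rfl h1, sum_range_diag
      (fun n j => (-1) ^ j * (dx n f * dx j (A.coeff ((n + j + 1 : ℕ) : ℤ) * g)))]
    · refine Finset.sum_congr rfl fun l _ => ?_
      rw [Finset.Nat.sum_antidiagonal_eq_sum_range_succ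
        (fun n j => (-1) ^ j * (dx n f * dx j (A.coeff ((n + j + 1 : ℕ) : ℤ) * g))) l,
        ← Finset.sum_range_reflect]
      refine Finset.sum_congr rfl fun m hm => ?_
      have hm' : m ≤ l := by simpa [Nat.lt_succ_iff] using hm
      rw [show l + 1 - 1 - (l + 1 - 1 - m) = m by omega, show m + (l - m) = l by omega]
      rfl
    · intro i j hij
      rw [hM _ (by push_cast; omega), zero_mul, dx_zero_right, mul_zero, mul_zero]
  · intro n hn
    by_contra h
    have h' : M < n := by simpa [Nat.lt_succ_iff] using h
    refine hn (Finset.sum_eq_zero fun m _ => ?_)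
    rw [hM _ (by omega), zero_mul, dx_zero_right, mul_zero, mul_zero]
  · intro s hs
    rw [hD s (by omega)]
    exact Finset.sum_eq_zero fun j _ => by rw [hgA _ (by omega), dx_zero_right, mul_zero]

/-! ### Calculus of purely pseudo-differential parts -/

/-- The operator has no negative powers of `D`. -/
def IsDiff (A : PDO R) : Prop := ∀ n, n < 0 → A.coeff n = 0

/-- The operator has order at most `N`. -/
def OrdLE (A : PDO R) (N : ℤ) : Prop := ∀ n, N < n → A.coeff n = 0

theorem OrdLE.mul {A B : PDO R} {N M : ℤ} (hA : A.OrdLE N) (hB : B.OrdLE M) :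
    (A * B).OrdLE (N + M) := fun _ hn => coeff_mul_eq_zero hA hB _ hn

theorem OrdLE.coeff_mul {A B : PDO R} {N M : ℤ} (hA : A.OrdLE N) (hB : B.OrdLE M) :
    (A * B).coeff (N + M) = A.coeff N * B.coeff M := by
  rw [coeff_mul_eq_sum hA hB _ 1 (by push_cast; omega)]
  simp [dx]

theorem ordLE_ofFun (f : R) : (ofFun f).OrdLE 0 := fun _ hn => if_neg (by omega)

theorem ordLE_D (n : ℤ) : (D n : PDO R).OrdLE n := fun _ hn => if_neg (by omega)

theorem ordLE_neg (A : PDO R) : A.neg.OrdLE (-1) := fun _ hn => if_neg (by omega)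

theorem ordLE_fDinvg (f g : R) : (fDinvg f g).OrdLE (-1) :=
  ((ordLE_ofFun f).mul (ordLE_D (-1))).mul (ordLE_ofFun g)

theorem isDiff_ofFun (f : R) : (ofFun f).IsDiff := fun _ hn => if_neg (by omega)

theorem isDiff_D {n : ℤ} (h : 0 ≤ n) : (D n : PDO R).IsDiff := fun _ hn => if_neg (by omega)

theorem isDiff_one : (1 : PDO R).IsDiff := isDiff_ofFun 1

theorem IsDiff.sub {A B : PDO R} (hA : A.IsDiff) (hB : B.IsDiff) : (A - B).IsDiff :=
  fun n hn => by rw [coeff_sub, hA n hn, hB n hn, sub_zero]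

theorem IsDiff.mul {A B : PDO R} (hA : A.IsDiff) (hB : B.IsDiff) : (A * B).IsDiff := by
  intro s hs
  rw [PDO.coeff_mul]
  refine finsum_eq_zero_of_forall_eq_zero ?_
  rintro ⟨i, j⟩
  dsimp only
  rcases lt_or_ge i 0 with hi | hi
  · rw [hA i hi, zero_mul, smul_zero]
  · rcases lt_or_ge (s - i + j) 0 with hj | hj
    · rw [hB _ hj, dx_zero_right, mul_zero, smul_zero]
    · lift i to ℕ using hi
      rw [Ring.choose_natCast, Nat.choose_eq_zero_of_lt (by omega)]
      simp

/-- The differential part `A₊ = ∑_{n ≥ 0} aₙ Dⁿ`. -/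
noncomputable def pos (A : PDO R) : PDO R := A - A.neg

theorem coeff_neg_part (A : PDO R) (n : ℤ) : A.neg.coeff n = if n < 0 then A.coeff n else 0 := rfl

theorem isDiff_pos (A : PDO R) : A.pos.IsDiff := fun n hn => by
  rw [pos, coeff_sub, coeff_neg_part, if_pos hn, sub_self]

theorem pos_add_neg (A : PDO R) : A.pos + A.neg = A := sub_add_cancel _ _

theorem neg_part_eq_zero {A : PDO R} (h : A.IsDiff) : A.neg = 0 := by
  ext n
  rw [coeff_neg_part]
  split_ifs with hn
  · exact h n hn
  · rfl

theorem neg_part_eq_self {A : PDO R} (h : A.OrdLE (-1)) : A.neg = A := by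
  ext n
  rw [coeff_neg_part]
  split_ifs with hn
  · rfl
  · exact (h n (by omega)).symm

theorem neg_part_add (A B : PDO R) : (A + B).neg = A.neg + B.neg := by
  ext n
  simp only [coeff_neg_part, coeff_add]
  split_ifs <;> simp

/-- Taking the purely pseudo-differential part, as an additive map. -/
noncomputable def negHom : PDO R →+ PDO R := AddMonoidHom.mk' neg neg_part_add

theorem neg_part_sub (A B : PDO R) : (A - B).neg = A.neg - B.neg := map_sub negHom A B

theorem neg_part_sum {ι : Type*} (s : Finset ι) (A : ι → PDO R) :
    (∑ i ∈ s, A i).neg = ∑ i ∈ s, (A i).neg := map_sum negHom A s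

theorem neg_mul_ofFun (A : PDO R) (f : R) : (A * ofFun f).neg = A.neg * ofFun f := by
  conv_lhs => rw [← pos_add_neg A, add_mul, neg_part_add,
    neg_part_eq_zero (A.isDiff_pos.mul (isDiff_ofFun f)),
    neg_part_eq_self (A.ordLE_neg.mul (ordLE_ofFun f)), zero_add]

theorem neg_ofFun_mul (A : PDO R) (f : R) : (ofFun f * A).neg = ofFun f * A.neg := by
  ext n
  simp only [coeff_neg_part, coeff_ofFun_mul]
  split_ifs <;> simp

theorem neg_isDiff_mul {P : PDO R} (hP : P.IsDiff) (A : PDO R) :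
    (P * A).neg = (P * A.neg).neg := by
  conv_lhs => rw [← pos_add_neg A, mul_add, neg_part_add, neg_part_eq_zero (hP.mul A.isDiff_pos),
    zero_add]

theorem neg_mul_isDiff {P : PDO R} (hP : P.IsDiff) (A : PDO R) :
    (A * P).neg = (A.neg * P).neg := by
  conv_lhs => rw [← pos_add_neg A, add_mul, neg_part_add, neg_part_eq_zero (A.isDiff_pos.mul hP),
    zero_add]

theorem ofFun_zero : ofFun (0 : R) = 0 := by
  ext n
  rw [coeff_ofFun, ite_self]
  rfl

theorem ofFun_add (f g : R) : ofFun (f + g) = ofFun f + ofFun g := by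
  ext n
  simp only [coeff_ofFun, coeff_add]
  split_ifs <;> simp

/-- Multiplication operators, as a ring homomorphism. -/
noncomputable def ofFunHom : R →+* PDO R where
  toFun := ofFun
  map_one' := ofFun_one
  map_mul' f g := (ofFun_mul_ofFun f g).symm
  map_zero' := ofFun_zero
  map_add' := ofFun_add

theorem ofFun_neg (f : R) : ofFun (-f) = -ofFun f := map_neg ofFunHom f

theorem ofFun_sub (f g : R) : ofFun (f - g) = ofFun f - ofFun g := map_sub ofFunHom f g

theorem ofFun_sum {ι : Type*} (s : Finset ι) (f : ι → R) :
    ofFun (∑ i ∈ s, f i) = ∑ i ∈ s, ofFun (f i) := map_sum ofFunHom f s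

theorem D_one_mul_ofFun (f : R) : D 1 * ofFun f = ofFun f * D 1 + ofFun (f′) := by
  ext s
  rw [coeff_add, coeff_ofFun_mul]
  rw [coeff_D_mul _ 1 s (2 - s).toNat fun n hn => if_neg (by omega)]
  rcases lt_or_ge 1 s with hs | hs
  · rw [coeff_D, coeff_ofFun, if_neg (by omega), if_neg (by omega),
      show (2 - s).toNat = 0 by omega]
    simp
  · obtain ⟨n, rfl⟩ : ∃ n : ℕ, s = 1 - n := ⟨(1 - s).toNat, by omega⟩
    rw [show (2 - (1 - (n : ℤ))).toNat = n + 1 by omega, Finset.sum_eq_single n]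
    · rw [coeff_D, coeff_ofFun, coeff_ofFun, if_pos (by omega)]
      match n with
      | 0 => simp [dx]
      | 1 => simp [dx]
      | n + 2 =>
        rw [if_neg (by push_cast; omega), if_neg (by push_cast; omega),
          show (1 : ℤ) = ((1 : ℕ) : ℤ) by rfl, Ring.choose_natCast,
          Nat.choose_eq_zero_of_lt (by omega)]
        simp
    · intro j _ hj
      rw [coeff_ofFun, if_neg (by omega), dx_zero_right, smul_zero]
    · simp

theorem Dinv_mul_D : D (-1) * D 1 = (1 : PDO R) := by rw [D_mul_D]; rfl

theorem D_mul_Dinv : D 1 * D (-1) = (1 : PDO R) := by rw [D_mul_D]; rfl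

theorem Dinv_mul_ofFun_mul_D (f : R) :
    D (-1) * ofFun f * D 1 = ofFun f - D (-1) * ofFun (f′) := by
  rw [eq_sub_iff_add_eq, mul_assoc, ← mul_add, ← D_one_mul_ofFun, ← mul_assoc, Dinv_mul_D, one_mul]

theorem D_mul_ofFun_mul_Dinv (f : R) :
    D 1 * ofFun f * D (-1) = ofFun f + ofFun (f′) * D (-1) := by
  rw [D_one_mul_ofFun, add_mul, mul_assoc, D_mul_Dinv, mul_one]

/-- Integration by parts for multiplication operators. -/
theorem Dinv_mul_deriv_mul_Dinv (f : R) :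
    D (-1) * ofFun (f′) * D (-1) = ofFun f * D (-1) - D (-1) * ofFun f := by
  have h := D_one_mul_ofFun f
  rw [← sub_eq_iff_eq_add'] at h
  rw [← h, mul_sub, sub_mul, ← mul_assoc, Dinv_mul_D, one_mul, mul_assoc, mul_assoc, D_mul_Dinv,
    mul_one]

theorem neg_mul_Dinv {A : PDO R} (hA : A.IsDiff) :
    (A * D (-1)).neg = ofFun (A.coeff 0) * D (-1) := by
  ext n
  rw [coeff_neg_part, coeff_mul_D, coeff_ofFun_mul, coeff_D]
  split_ifs with h1 h2 h2
  · subst h2; simp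
  · rw [hA _ (by omega), mul_zero]
  · omega
  · rw [mul_zero]

theorem neg_isDiff_mul_ofFun_mul_Dinv {A : PDO R} (hA : A.IsDiff) (f : R) :
    (A * ofFun f * D (-1)).neg = ofFun (A.posApply f) * D (-1) := by
  rw [neg_mul_Dinv (hA.mul (isDiff_ofFun f)), posApply_eq_coeff]

theorem neg_isDiff_mul_fDinvg {A : PDO R} (hA : A.IsDiff) (f g : R) :
    (A * fDinvg f g).neg = fDinvg (A.posApply f) g := by
  rw [fDinvg, ← mul_assoc, ← mul_assoc, neg_mul_ofFun, neg_isDiff_mul_ofFun_mul_Dinv hA, fDinvg]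

theorem posApply_pos (A : PDO R) (f : R) : A.pos.posApply f = A.posApply f := by
  unfold posApply
  refine finsum_congr fun n => ?_
  rw [pos, coeff_sub, coeff_neg_part, if_neg (by omega), sub_zero]

theorem posAdjApply_pos (A : PDO R) (f : R) : A.pos.posAdjApply f = A.posAdjApply f := by
  unfold posAdjApply
  refine finsum_congr fun n => ?_
  rw [pos, coeff_sub, coeff_neg_part, if_neg (by omega), sub_zero]

theorem eq_ofFun {A : PDO R} (h1 : A.IsDiff) (h2 : A.OrdLE 0) : A = ofFun (A.coeff 0) := by
  ext n
  rw [coeff_ofFun]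
  split_ifs with h
  · rw [h]
  · rcases lt_or_gt_of_ne h with h | h
    · exact h1 n h
    · exact h2 n h

theorem coeff_Dinv_mul_ofFun (f : R) : (D (-1) * ofFun f).coeff (-1) = f := by
  have h := (ordLE_D (R := R) (-1)).coeff_mul (ordLE_ofFun f)
  rw [add_zero] at h
  rw [h, coeff_D, coeff_ofFun, if_pos rfl, if_pos rfl, one_mul]

/-- D times the left-hand side is a difference of differential operators and has order at most 0,
hence is a function; this function is then read off as a residue. -/
theorem neg_Dinv_mul {B : PDO R} (hB : B.IsDiff) :
    (D (-1) * B).neg = D (-1) * ofFun ((D (-1) * B).coeff (-1)) := by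
  have h1 : D 1 * (D (-1) * B).neg = B - D 1 * (D (-1) * B).pos := by
    rw [eq_sub_iff_add_eq', ← mul_add, pos_add_neg, ← mul_assoc, D_mul_Dinv, one_mul]
  have h2 : (D 1 * (D (-1) * B).neg).IsDiff := by
    rw [h1]
    exact hB.sub ((isDiff_D (by norm_num)).mul (isDiff_pos _))
  have h3 : (D 1 * (D (-1) * B).neg).OrdLE 0 := (ordLE_D 1).mul (ordLE_neg _)
  have h4 : (D (-1) * B).neg = D (-1) * ofFun ((D 1 * (D (-1) * B).neg).coeff 0) := by
    rw [← eq_ofFun h2 h3, ← mul_assoc, Dinv_mul_D, one_mul]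
  have h5 := congrArg (fun A : PDO R => A.coeff (-1)) h4
  simp only [coeff_Dinv_mul_ofFun, coeff_neg_part] at h5
  rw [h4, ← h5, if_pos (by norm_num)]

theorem neg_Dinv_mul_ofFun_mul_isDiff {A : PDO R} (hA : A.IsDiff) (g : R) :
    (D (-1) * ofFun g * A).neg = D (-1) * ofFun (A.posAdjApply g) := by
  rw [posAdjApply_eq_coeff, mul_assoc, neg_Dinv_mul ((isDiff_ofFun g).mul hA)]

theorem neg_fDinvg_mul_isDiff {A : PDO R} (hA : A.IsDiff) (f g : R) :
    (fDinvg f g * A).neg = fDinvg f (A.posAdjApply g) := by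
  rw [fDinvg, mul_assoc (ofFun f), mul_assoc (ofFun f), neg_ofFun_mul,
    neg_Dinv_mul_ofFun_mul_isDiff hA, fDinvg, mul_assoc]

theorem fDinvg_add_left (f f' g : R) : fDinvg (f + f') g = fDinvg f g + fDinvg f' g := by
  simp only [fDinvg, ofFun_add, add_mul]

theorem fDinvg_add_right (f g g' : R) : fDinvg f (g + g') = fDinvg f g + fDinvg f g' := by
  simp only [fDinvg, ofFun_add, mul_add]

theorem fDinvg_neg_right (f g : R) : fDinvg f (-g) = -fDinvg f g := by
  simp only [fDinvg, ofFun_neg, mul_neg]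

theorem fDinvg_sub_left (f f' g : R) : fDinvg (f - f') g = fDinvg f g - fDinvg f' g := by
  simp only [fDinvg, ofFun_sub, sub_mul]

theorem fDinvg_sub_right (f g g' : R) : fDinvg f (g - g') = fDinvg f g - fDinvg f g' := by
  simp only [fDinvg, ofFun_sub, mul_sub]

theorem fDinvg_zero_left (g : R) : fDinvg 0 g = 0 := by
  simp only [fDinvg, ofFun_zero, zero_mul]

theorem fDinvg_zero_right (f : R) : fDinvg f 0 = 0 := by
  simp only [fDinvg, ofFun_zero, mul_zero]

theorem fDinvg_sum_left {ι : Type*} (s : Finset ι) (f : ι → R) (g : R) :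
    fDinvg (∑ i ∈ s, f i) g = ∑ i ∈ s, fDinvg (f i) g := by
  simp only [fDinvg, ofFun_sum, Finset.sum_mul]

theorem fDinvg_sum_right {ι : Type*} (s : Finset ι) (f : R) (g : ι → R) :
    fDinvg f (∑ i ∈ s, g i) = ∑ i ∈ s, fDinvg f (g i) := by
  simp only [fDinvg, ofFun_sum, Finset.mul_sum]

theorem ofFun_mul_fDinvg (h f g : R) : ofFun h * fDinvg f g = fDinvg (h * f) g := by
  rw [fDinvg, fDinvg, ← ofFun_mul_ofFun]
  simp only [mul_assoc]

theorem fDinvg_mul_ofFun (f g h : R) : fDinvg f g * ofFun h = fDinvg f (g * h) := by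
  rw [fDinvg, fDinvg, ← ofFun_mul_ofFun, mul_assoc]

/-- Composition of two integral operators through an antiderivative. -/
theorem fDinvg_mul_fDinvg {f g f' g' ω : R} (h : ω′ = g * f') :
    fDinvg f g * fDinvg f' g' = fDinvg (f * ω) g' - fDinvg f (ω * g') := by
  have h1 := congrArg (fun A => ofFun f * A * ofFun g') (Dinv_mul_deriv_mul_Dinv ω)
  simp only [h, ← ofFun_mul_ofFun] at h1
  simp only [fDinvg, ← ofFun_mul_ofFun]
  linear_combination (norm := noncomm_ring) h1

theorem coeff_fDinvg (f g : R) : (fDinvg f g).coeff (-1) = f * g := by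
  rw [fDinvg, mul_assoc, coeff_ofFun_mul, coeff_Dinv_mul_ofFun]

theorem coeff_neg_one_fDinvg_one_mul (A : PDO R) (g : R) :
    (fDinvg 1 g * A).coeff (-1) = A.posAdjApply g := by
  rw [posAdjApply_eq_coeff, fDinvg, ofFun_one, one_mul]

theorem coeff_neg_one_mul_fDinvg_one (A : PDO R) (f : R) :
    (A * fDinvg f 1).coeff (-1) = A.posApply f := by
  rw [posApply_eq_coeff, fDinvg, ofFun_one, mul_one, ← mul_assoc, coeff_mul_D]
  rfl

theorem boundary_eq_posApply (A : PDO R) (f g : R) :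
    A.boundary f g = (fDinvg 1 g * A).posApply f := by
  rw [boundary_eq_coeff, posApply_eq_coeff, fDinvg, ofFun_one, one_mul]

theorem coeff_neg_one_mul_ofFun (A : PDO R) (f : R) :
    (A * ofFun f).coeff (-1) = A.coeff (-1) * f := by
  have h1 := congrArg (fun B : PDO R => B.coeff (-1)) (neg_mul_ofFun A f)
  have h2 := (ordLE_neg A).coeff_mul (ordLE_ofFun f)
  rw [add_zero] at h2
  simp only [h2, coeff_neg_part, coeff_ofFun] at h1
  simpa using h1

theorem fDinvg_eq_zero_left {f g : R} (hg : IsUnit g) (h : fDinvg f g = 0) : f = 0 := by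
  have h1 := congrArg (fun A : PDO R => A.coeff (-1)) h
  simp only [coeff_fDinvg, coeff_zero] at h1
  exact (hg.mul_left_eq_zero).mp h1

/-- The operator `ofFun f` is central if `f` is a constant. -/
theorem ofFun_mul_comm_of_deriv_eq_zero {c : R} (hc : c′ = 0) (A : PDO R) :
    ofFun c * A = A * ofFun c := by
  have hd : ∀ j, dx (j + 1) c = 0 := fun j => by rw [dx_succ_in, hc, dx_zero_right]
  ext s
  obtain ⟨M, hM⟩ := A.exists_bound s
  rw [coeff_ofFun_mul, coeff_mul_ofFun A c s (M + 1) (fun n hn => hM n (by push_cast at hn; omega)),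
    Finset.sum_range_succ', Finset.sum_eq_zero (fun j _ => by rw [hd, mul_zero, smul_zero]),
    zero_add]
  simp [dx, mul_comm]

/-! ### Derivations acting on operators -/

section MapDer

variable {δ : Derivation ℤ R R}

theorem coeff_mapDer (δ : Derivation ℤ R R) (A : PDO R) (n : ℤ) :
    (mapDer δ A).coeff n = δ (A.coeff n) := rfl

theorem mapDer_neg_part (δ : Derivation ℤ R R) (A : PDO R) : mapDer δ A.neg = (mapDer δ A).neg := by
  ext n
  rw [coeff_mapDer, coeff_neg_part, coeff_neg_part, coeff_mapDer]
  split_ifs <;> simp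

theorem mapDer_ofFun (δ : Derivation ℤ R R) (f : R) : mapDer δ (ofFun f) = ofFun (δ f) := by
  ext n
  rw [coeff_mapDer, coeff_ofFun, coeff_ofFun]
  split_ifs <;> simp

theorem mapDer_D (δ : Derivation ℤ R R) (n : ℤ) : mapDer δ (D n) = 0 := by
  ext m
  rw [coeff_mapDer, coeff_D]
  split_ifs <;> simp

theorem map_dx (hδ : ∀ f : R, δ (f′) = (δ f)′) (j : ℕ) (f : R) : δ (dx j f) = dx j (δ f) := by
  induction j with
  | zero => rfl
  | succ j ih => rw [dx_succ, hδ, ih, dx_succ]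

theorem mapDer_mul (hδ : ∀ f : R, δ (f′) = (δ f)′) (A B : PDO R) :
    mapDer δ (A * B) = mapDer δ A * B + A * mapDer δ B := by
  obtain ⟨NA, hA⟩ := A.bdd
  obtain ⟨NB, hB⟩ := B.bdd
  have hA' : ∀ n, NA < n → (mapDer δ A).coeff n = 0 := fun n hn => by
    rw [coeff_mapDer, hA n hn, map_zero]
  have hB' : ∀ n, NB < n → (mapDer δ B).coeff n = 0 := fun n hn => by
    rw [coeff_mapDer, hB n hn, map_zero]
  ext s
  obtain ⟨M, hM⟩ : ∃ M : ℕ, NA + NB - s < M := ⟨(NA + NB - s).toNat + 1, by omega⟩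
  rw [coeff_mapDer, coeff_add, coeff_mul_eq_sum hA hB s M hM, coeff_mul_eq_sum hA' hB s M hM,
    coeff_mul_eq_sum hA hB' s M hM, map_sum, ← Finset.sum_add_distrib]
  refine Finset.sum_congr rfl fun i _ => ?_
  rw [map_sum, ← Finset.sum_add_distrib]
  refine Finset.sum_congr rfl fun j _ => ?_
  rw [map_zsmul, Derivation.leibniz, ← smul_add, map_dx hδ, coeff_mapDer, coeff_mapDer]
  simp only [smul_eq_mul]
  congr 1
  ring

theorem mapDer_fDinvg (hδ : ∀ f : R, δ (f′) = (δ f)′) (f g : R) :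
    mapDer δ (fDinvg f g) = fDinvg (δ f) g + fDinvg f (δ g) := by
  rw [fDinvg, mapDer_mul hδ, mapDer_mul hδ, mapDer_ofFun, mapDer_ofFun, mapDer_D, mul_zero,
    add_zero, fDinvg, fDinvg]

theorem mapDer_inv (hδ : ∀ f : R, δ (f′) = (δ f)′) (W : (PDO R)ˣ) {N : PDO R}
    (h : mapDer δ (W : PDO R) = N * W) :
    mapDer δ ((W⁻¹ : (PDO R)ˣ) : PDO R) = -(((W⁻¹ : (PDO R)ˣ) : PDO R) * N) := by
  have h1 := congrArg (mapDer δ) (W.mul_inv)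
  rw [mapDer_mul hδ, h, ← ofFun_one, mapDer_ofFun, Derivation.map_one_eq_zero, ofFun_zero,
    mul_assoc, W.mul_inv, mul_one] at h1
  have h2 := congrArg (fun A => ((W⁻¹ : (PDO R)ˣ) : PDO R) * A) h1
  simp only [mul_add, mul_zero, ← mul_assoc, W.inv_mul, one_mul] at h2
  exact eq_neg_of_add_eq_zero_right h2

/-- N = δW · W⁻¹ acts as a connection. The lemma serves twice: with W the dressing operator for the
Lax equations, and with W = T for the flow of L̃. -/
theorem mapDer_conj (hδ : ∀ f : R, δ (f′) = (δ f)′) (W : (PDO R)ˣ) {N A G : PDO R}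
    (h : mapDer δ (W : PDO R) = N * W) (hA : mapDer δ A = G) :
    mapDer δ (W * A * ((W⁻¹ : (PDO R)ˣ) : PDO R)) =
      ⁅N, W * A * ((W⁻¹ : (PDO R)ˣ) : PDO R)⁆ + W * G * ((W⁻¹ : (PDO R)ˣ) : PDO R) := by
  rw [mapDer_mul hδ, mapDer_mul hδ, mapDer_inv hδ W h, h, hA, Ring.lie_def]
  noncomm_ring

end MapDer

/-! ### The operator T = Φ D Φ⁻¹ -/

section Darboux

variable (u : Rˣ)

theorem darboux_val : (darboux u : PDO R) = ofFun (u : R) * D 1 * ofFun ((u⁻¹ : Rˣ) : R) := rfl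

theorem darboux_inv : ((darboux u)⁻¹ : (PDO R)ˣ) = fDinvg (u : R) ((u⁻¹ : Rˣ) : R) := by
  rw [darboux, mul_inv_rev, mul_inv_rev, inv_inv, fDinvg, mul_assoc]
  rfl

theorem isDiff_darboux : (darboux u : PDO R).IsDiff :=
  ((isDiff_ofFun _).mul (isDiff_D (by norm_num))).mul (isDiff_ofFun _)

theorem ordLE_darboux : (darboux u : PDO R).OrdLE 1 :=
  ((ordLE_ofFun _).mul (ordLE_D 1)).mul (ordLE_ofFun _)

theorem coeff_one_darboux : (darboux u : PDO R).coeff 1 = 1 := by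
  have h1 := ((ordLE_ofFun (u : R)).mul (ordLE_D (R := R) 1)).coeff_mul
    (ordLE_ofFun ((u⁻¹ : Rˣ) : R))
  have h2 := (ordLE_ofFun (u : R)).coeff_mul (ordLE_D (R := R) 1)
  rw [zero_add] at h2
  rw [zero_add, add_zero, h2] at h1
  rw [darboux_val, h1]
  simp [coeff_ofFun, coeff_D]

theorem ordLE_darboux_inv : (((darboux u)⁻¹ : (PDO R)ˣ) : PDO R).OrdLE (-1) := by
  rw [darboux_inv]
  exact ordLE_fDinvg _ _

theorem darboux_mul_fDinvg (f g : R) :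
    (darboux u : PDO R) * fDinvg f g = fDinvg (darbouxApply u f) g + ofFun (f * g) := by
  have h := congrArg (fun A => ofFun (u : R) * A * ofFun g)
    (D_mul_ofFun_mul_Dinv (((u⁻¹ : Rˣ) : R) * f))
  simp only [mul_add, add_mul] at h
  have h1 : ofFun (f * g) = ofFun (u : R) * ofFun (((u⁻¹ : Rˣ) : R) * f) * ofFun g := by
    rw [ofFun_mul_ofFun, ofFun_mul_ofFun, Units.mul_inv_cancel_left]
  rw [h1, darboux_val, darbouxApply, fDinvg, fDinvg, ← ofFun_mul_ofFun (u : R)]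
  rw [← ofFun_mul_ofFun _ f] at h ⊢
  linear_combination (norm := noncomm_ring) h

theorem fDinvg_mul_darboux (f g : R) :
    fDinvg f g * (darboux u : PDO R) =
      ofFun (f * g) - fDinvg f ((g * u)′ * ((u⁻¹ : Rˣ) : R)) := by
  have h := congrArg (fun A => ofFun f * A * ofFun ((u⁻¹ : Rˣ) : R))
    (Dinv_mul_ofFun_mul_D (g * u))
  simp only [mul_sub, sub_mul] at h
  have h1 : ofFun (f * g) = ofFun f * ofFun (g * u) * ofFun ((u⁻¹ : Rˣ) : R) := by
    rw [ofFun_mul_ofFun, ofFun_mul_ofFun, mul_assoc, mul_assoc g, Units.mul_inv, mul_one]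
  rw [h1, darboux_val, fDinvg, fDinvg, ← ofFun_mul_ofFun _ ((u⁻¹ : Rˣ) : R)]
  rw [← ofFun_mul_ofFun g] at h ⊢
  linear_combination (norm := noncomm_ring) h

theorem fDinvg_mul_darboux_inv {f g ω : R} (h : ω′ = g * u) :
    fDinvg f g * ((darboux u)⁻¹ : (PDO R)ˣ) =
      fDinvg (f * ω) ((u⁻¹ : Rˣ) : R) - fDinvg f (ω * ((u⁻¹ : Rˣ) : R)) := by
  rw [darboux_inv, fDinvg_mul_fDinvg h]

/-- This kernel property makes all terms beginning with Φ D⁻¹ disappear from purely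
pseudo-differential parts after multiplication by T. -/
theorem darbouxApply_self : darbouxApply u (u : R) = 0 := by
  rw [darbouxApply, Units.inv_mul, Derivation.map_one_eq_zero, mul_zero]

theorem neg_darboux_mul (A : PDO R) {f g : R} (h : A.neg = fDinvg f g) :
    ((darboux u : PDO R) * A).neg = fDinvg (darbouxApply u f) g := by
  rw [neg_isDiff_mul (isDiff_darboux u), h, darboux_mul_fDinvg, neg_part_add,
    neg_part_eq_zero (isDiff_ofFun _), add_zero, neg_part_eq_self (ordLE_fDinvg _ _)]

theorem neg_darboux_mul_fDinvg (f g : R) :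
    ((darboux u : PDO R) * fDinvg f g).neg = fDinvg (darbouxApply u f) g :=
  neg_darboux_mul u _ (neg_part_eq_self (ordLE_fDinvg _ _))

/-- The purely pseudo-differential part of a conjugate by the Darboux-Bäcklund operator. -/
theorem neg_darboux_conj (A : PDO R) :
    ((darboux u : PDO R) * A * ((darboux u)⁻¹ : (PDO R)ˣ)).neg =
      (darboux u : PDO R) * A.neg * ((darboux u)⁻¹ : (PDO R)ˣ) +
        fDinvg (darbouxApply u (A.posApply u)) ((u⁻¹ : Rˣ) : R) := by
  -- Orders add up to 1 - 1 - 1, so the conjugate of A₋ stays purely pseudo-differential; only A₊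
  -- T⁻¹ produces the extra term.
  have h1 : ((darboux u : PDO R) * A.neg * ((darboux u)⁻¹ : (PDO R)ˣ)).OrdLE (-1) :=
    ((ordLE_darboux u).mul (ordLE_neg A)).mul (ordLE_darboux_inv u)
  have h2 : (A.pos * ((darboux u)⁻¹ : (PDO R)ˣ)).neg =
      fDinvg (A.posApply u) ((u⁻¹ : Rˣ) : R) := by
    rw [darboux_inv, neg_isDiff_mul_fDinvg (isDiff_pos A), posApply_pos]
  conv_lhs => rw [← pos_add_neg A, mul_add, add_mul, neg_part_add, neg_part_eq_self h1,
    mul_assoc, neg_darboux_mul u _ h2, add_comm]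

/-- Varying both factors Φ and Φ⁻¹ leaves -Φ [D, Φ⁻¹ δΦ] Φ⁻¹, which is multiplication by -T(δΦ) Φ⁻¹.
The factor T is split off to obtain the shape required by `mapDer_conj`. -/
theorem mapDer_darboux {δ : Derivation ℤ R R} (hδ : ∀ f : R, δ (f′) = (δ f)′) :
    mapDer δ (darboux u : PDO R) =
      -fDinvg (darbouxApply u (δ u)) ((u⁻¹ : Rˣ) : R) * (darboux u : PDO R) := by
  have hi : δ ((u⁻¹ : Rˣ) : R) = -(((u⁻¹ : Rˣ) : R) * (((u⁻¹ : Rˣ) : R) * δ u)) := by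
    have h := congrArg δ u.inv_mul
    rw [Derivation.leibniz, Derivation.map_one_eq_zero] at h
    simp only [smul_eq_mul] at h
    linear_combination ((u⁻¹ : Rˣ) : R) * h - δ ((u⁻¹ : Rˣ) : R) * u.inv_mul
  rw [neg_mul, fDinvg_mul_darboux, Units.inv_mul, Derivation.map_one_eq_zero, zero_mul,
    fDinvg_zero_right, sub_zero, darboux_val, mapDer_mul hδ, mapDer_mul hδ, mapDer_D,
    mapDer_ofFun, mapDer_ofFun, mul_zero, add_zero, hi, darbouxApply]
  have h := congrArg (fun A => ofFun (u : R) * A * ofFun ((u⁻¹ : Rˣ) : R))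
    (D_one_mul_ofFun (((u⁻¹ : Rˣ) : R) * δ u))
  have h2 : ofFun (δ u) = ofFun (u : R) * ofFun (((u⁻¹ : Rˣ) : R) * δ u) := by
    rw [ofFun_mul_ofFun, Units.mul_inv_cancel_left]
  rw [h2, mul_comm ((u⁻¹ : Rˣ) : R) (_ * _), ofFun_neg, ← ofFun_mul_ofFun _ ((u⁻¹ : Rˣ) : R),
    ← ofFun_mul_ofFun _ ((u⁻¹ : Rˣ) : R), ← ofFun_mul_ofFun (u : R)]
  linear_combination (norm := noncomm_ring) -h

end Darboux

end PDO

/-! ### Products with L = L₊ + Φ D⁻¹ Ψ and the iterates -/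

namespace PDO

variable {R : Type*} [CommRing R] [Differential R] {L : PDO R} {Φ Ψ : R}

/-- L₊ acts on f, while Φ D⁻¹ Ψ composes with f D⁻¹ g through the antiderivative ω of Ψ f. The first
term is thus L(f) with the integration constant chosen in ω. -/
theorem neg_mul_fDinvg (hL : L.neg = fDinvg Φ Ψ) {f ω : R} (h : ω′ = f * Ψ) (g : R) :
    (L * fDinvg f g).neg = fDinvg (L.posApply f + Φ * ω) g - fDinvg Φ (ω * g) := by
  conv_lhs => rw [← pos_add_neg L, add_mul, neg_part_add, neg_isDiff_mul_fDinvg L.isDiff_pos,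
    posApply_pos, hL, fDinvg_mul_fDinvg (h.trans (mul_comm _ _)), neg_part_sub,
    neg_part_eq_self (ordLE_fDinvg _ _), neg_part_eq_self (ordLE_fDinvg _ _)]
  rw [fDinvg_add_left]
  abel

theorem neg_fDinvg_mul (hL : L.neg = fDinvg Φ Ψ) {g ω : R} (h : ω′ = Φ * g) (f : R) :
    (fDinvg f g * L).neg = fDinvg f (L.posAdjApply g - Ψ * ω) + fDinvg (f * ω) Ψ := by
  conv_lhs => rw [← pos_add_neg L, mul_add, neg_part_add, neg_fDinvg_mul_isDiff L.isDiff_pos,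
    posAdjApply_pos, hL, fDinvg_mul_fDinvg (h.trans (mul_comm _ _)), neg_part_sub,
    neg_part_eq_self (ordLE_fDinvg _ _), neg_part_eq_self (ordLE_fDinvg _ _)]
  rw [fDinvg_sub_right, mul_comm Ψ]
  abel

end PDO

namespace Iterates

open PDO

variable {R : Type*} [CommRing R] [Differential R] {L : PDO R} {Φ Ψ : R} {P : Iterates R}

namespace IsFor

theorem neg_mul_φ (hP : P.IsFor L Φ Ψ) (hL : L.neg = fDinvg Φ Ψ) (i : ℕ) (g : R) :
    (L * fDinvg (P.φ i) g).neg = fDinvg (P.φ (i + 1)) g - fDinvg Φ (P.Ω i 0 * g) := by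
  rw [neg_mul_fDinvg hL (ω := P.Ω i 0) (by rw [hP.deriv_Ω, hP.ψ_zero]), hP.φ_succ]

theorem neg_ψ_mul (hP : P.IsFor L Φ Ψ) (hL : L.neg = fDinvg Φ Ψ) (j : ℕ) (f : R) :
    (fDinvg f (P.ψ j) * L).neg = fDinvg f (P.ψ (j + 1)) + fDinvg (f * P.Ω 0 j) Ψ := by
  rw [neg_fDinvg_mul hL (ω := P.Ω 0 j) (by rw [hP.deriv_Ω, hP.φ_zero]), hP.ψ_succ]

/-- The differential part of D⁻¹ ψⱼ L acts on φᵢ as the boundary term B(φᵢ, ψⱼ); the relation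
`parts` is what turns the sum with the remaining integrals into Ω_{i+1,j}. -/
theorem neg_ψ_mul_φ (hP : P.IsFor L Φ Ψ) (hL : L.neg = fDinvg Φ Ψ) (i j : ℕ) :
    (fDinvg 1 (P.ψ j) * L * fDinvg (P.φ i) 1).neg =
      fDinvg (P.Ω (i + 1) j) 1 - fDinvg 1 (P.Ω i (j + 1)) - fDinvg (P.Ω 0 j) (P.Ω i 0) := by
  have h1 : (P.Ω i (j + 1))′ = P.ψ (j + 1) * P.φ i := by rw [hP.deriv_Ω, mul_comm]
  have h2 : (P.Ω i 0)′ = Ψ * P.φ i := by rw [hP.deriv_Ω, hP.ψ_zero, mul_comm]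
  rw [← pos_add_neg (fDinvg 1 (P.ψ j) * L), add_mul, neg_part_add, hP.neg_ψ_mul hL, add_mul,
    fDinvg_mul_fDinvg h1, fDinvg_mul_fDinvg h2, neg_isDiff_mul_fDinvg (isDiff_pos _),
    posApply_pos, ← boundary_eq_posApply, neg_part_add, neg_part_sub, neg_part_sub]
  simp only [neg_part_eq_self (ordLE_fDinvg _ _), one_mul, mul_one]
  have h3 : P.Ω (i + 1) j = L.boundary (P.φ i) (P.ψ j) + P.Ω i (j + 1) + P.Ω 0 j * P.Ω i 0 := by
    linear_combination hP.parts i j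
  rw [h3, fDinvg_add_left, fDinvg_add_left]
  abel

end IsFor

/-- The iterates are characterized by the purely pseudo-differential parts of products. -/
theorem isFor_of_neg (h0 : P.φ 0 = Φ) (h0' : P.ψ 0 = Ψ)
    (hΩ : ∀ i j, (P.Ω i j)′ = P.φ i * P.ψ j)
    (hφ : ∀ i, (L * fDinvg (P.φ i) 1).neg = fDinvg (P.φ (i + 1)) 1 - fDinvg Φ (P.Ω i 0))
    (hψ : ∀ j, (fDinvg 1 (P.ψ j) * L).neg = fDinvg 1 (P.ψ (j + 1)) + fDinvg (P.Ω 0 j) Ψ)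
    (hp : ∀ i j, (fDinvg 1 (P.ψ j) * L * fDinvg (P.φ i) 1).neg =
      fDinvg (P.Ω (i + 1) j) 1 - fDinvg 1 (P.Ω i (j + 1)) - fDinvg (P.Ω 0 j) (P.Ω i 0)) :
    P.IsFor L Φ Ψ where
  φ_zero := h0
  ψ_zero := h0'
  deriv_Ω := hΩ
  φ_succ i := by
    have h := congrArg (fun A : PDO R => A.coeff (-1)) (hφ i)
    simp only [coeff_neg_part, coeff_sub, coeff_fDinvg, coeff_neg_one_mul_fDinvg_one] at h
    rw [if_pos (by norm_num)] at h
    linear_combination -h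
  ψ_succ j := by
    have h := congrArg (fun A : PDO R => A.coeff (-1)) (hψ j)
    simp only [coeff_neg_part, coeff_add, coeff_fDinvg, coeff_neg_one_fDinvg_one_mul] at h
    rw [if_pos (by norm_num)] at h
    linear_combination -h
  parts i j := by
    have h := congrArg (fun A : PDO R => A.coeff (-1)) (hp i j)
    simp only [coeff_neg_part, coeff_sub, coeff_fDinvg, coeff_neg_one_mul_fDinvg_one] at h
    rw [if_pos (by norm_num), ← boundary_eq_posApply] at h
    linear_combination -h

namespace IsFor

/-- The purely pseudo-differential parts of the powers of a Lax operator `L₊ + Φ D⁻¹ Ψ`. -/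
theorem neg_pow_aux (hP : P.IsFor L Φ Ψ) (hL : L.neg = fDinvg Φ Ψ) (n : ℕ) :
    (L ^ n).neg = ∑ m ∈ Finset.range n, fDinvg (P.φ (n - 1 - m)) (P.ψ m) ∧
    ∀ j, (fDinvg 1 (P.ψ j) * L ^ n).neg = fDinvg 1 (P.ψ (j + n)) +
      ∑ m ∈ Finset.range n, fDinvg (P.Ω (n - 1 - m) j) (P.ψ m) := by
  -- The two claims are proved together. The first at n + 1 uses the second at j = 0, through Lⁿ⁺¹ =
  -- L₊ Lⁿ + Φ D⁻¹ Ψ Lⁿ; the second at j uses the first at n, and itself at n for j + 1 and for 0.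
  induction n with
  | zero =>
    simp only [pow_zero, mul_one, Finset.range_zero, Finset.sum_empty, add_zero]
    exact ⟨neg_part_eq_zero isDiff_one, fun j => neg_part_eq_self (ordLE_fDinvg _ _)⟩
  | succ n ih =>
    obtain ⟨ih1, ih2⟩ := ih
    have hsub : ∀ m ∈ Finset.range n, n + 1 - 1 - m = n - 1 - m + 1 := fun m hm => by
      have : m < n := by simpa using hm
      omega
    constructor
    · have h1 : (L ^ (n + 1)).neg = (L.pos * L ^ n).neg + (ofFun Φ * (fDinvg 1 Ψ * L ^ n)).neg := by
        rw [← neg_part_add, ← mul_assoc, ofFun_mul_fDinvg, mul_one, ← hL, ← add_mul, pos_add_neg,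
          pow_succ']
      rw [h1, neg_isDiff_mul (isDiff_pos L), ih1, neg_ofFun_mul, ← hP.ψ_zero, ih2 0,
        Finset.mul_sum, neg_part_sum, Finset.sum_range_succ, mul_add, Finset.mul_sum]
      simp only [neg_isDiff_mul_fDinvg (isDiff_pos L), posApply_pos, ofFun_mul_fDinvg]
      rw [add_comm (fDinvg (Φ * 1) _), ← add_assoc, ← Finset.sum_add_distrib]
      congr 1
      · refine Finset.sum_congr rfl fun m hm => ?_
        rw [hsub m hm, hP.φ_succ, fDinvg_add_left]
      · rw [mul_one, zero_add, show n + 1 - 1 - n = 0 by omega, hP.φ_zero]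
    · intro j
      have h1 : (fDinvg 1 (P.ψ j) * L ^ (n + 1)).neg =
          ((fDinvg 1 (P.ψ j) * L).pos * L ^ n).neg + (fDinvg 1 (P.ψ (j + 1)) * L ^ n).neg +
            (ofFun (P.Ω 0 j) * (fDinvg 1 Ψ * L ^ n)).neg := by
        rw [← neg_part_add, ← neg_part_add, ← mul_assoc (ofFun _), ofFun_mul_fDinvg, mul_one,
          ← add_mul,
          ← add_mul, add_assoc, show fDinvg (P.Ω 0 j) Ψ = fDinvg (1 * P.Ω 0 j) Ψ by rw [one_mul],
          ← hP.neg_ψ_mul hL, pos_add_neg, pow_succ', mul_assoc]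
      rw [h1, neg_isDiff_mul (isDiff_pos _), ih1, neg_ofFun_mul, ← hP.ψ_zero, ih2 0, ih2 (j + 1),
        Finset.mul_sum, neg_part_sum, Finset.sum_range_succ, mul_add, Finset.mul_sum]
      simp only [neg_isDiff_mul_fDinvg (isDiff_pos _), posApply_pos, ← boundary_eq_posApply,
        ofFun_mul_fDinvg]
      have h2 : ∀ m ∈ Finset.range n, fDinvg (P.Ω (n + 1 - 1 - m) j) (P.ψ m) =
          fDinvg (L.boundary (P.φ (n - 1 - m)) (P.ψ j)) (P.ψ m) +
          fDinvg (P.Ω (n - 1 - m) (j + 1)) (P.ψ m) +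
          fDinvg (P.Ω 0 j * P.Ω (n - 1 - m) 0) (P.ψ m) := by
        intro m hm
        rw [hsub m hm, ← fDinvg_add_left, ← fDinvg_add_left]
        congr 1
        linear_combination hP.parts (n - 1 - m) j
      rw [Finset.sum_congr rfl h2, Finset.sum_add_distrib, Finset.sum_add_distrib, mul_one,
        show n + 1 - 1 - n = 0 by omega, show j + 1 + n = j + (n + 1) by omega, zero_add]
      abel

theorem neg_pow (hP : P.IsFor L Φ Ψ) (hL : L.neg = fDinvg Φ Ψ) (n : ℕ) :
    (L ^ n).neg = ∑ m ∈ Finset.range n, fDinvg (P.φ (n - 1 - m)) (P.ψ m) :=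
  (hP.neg_pow_aux hL n).1

/-! ### Transformation of the iterates under T -/

section Darboux

variable {u : Rˣ}

/-- Since T(f) = Φ ∂(Φ⁻¹ f), the integrand Ψ̃ φ̃ᵢ is an exact derivative; this gives the integration
constant of Ω̃_{i0}. -/
theorem darboux_φ_antideriv (P : Iterates R) (u : Rˣ) (i : ℕ) :
    (((u⁻¹ : Rˣ) : R) * P.φ (i + 1))′ = ((u⁻¹ : Rˣ) : R) * (P.darboux u).φ i := by
  show _ = ((u⁻¹ : Rˣ) : R) * ((u : R) * _)
  rw [Units.inv_mul_cancel_left]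

theorem darboux_inv_mul_φ (P : Iterates R) (u : Rˣ) (i : ℕ) :
    (((PDO.darboux u)⁻¹ : (PDO R)ˣ) : PDO R) * fDinvg ((P.darboux u).φ i) 1 =
      fDinvg (P.φ (i + 1)) 1 - fDinvg (u : R) (((u⁻¹ : Rˣ) : R) * P.φ (i + 1)) := by
  rw [darboux_inv, fDinvg_mul_fDinvg (darboux_φ_antideriv P u i), Units.mul_inv_cancel_left,
    mul_one]

theorem darboux_ψ_zero_mul (P : Iterates R) (u : Rˣ) :
    fDinvg 1 ((P.darboux u).ψ 0) * (PDO.darboux u : PDO R) = ofFun ((u⁻¹ : Rˣ) : R) := by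
  show fDinvg 1 ((u⁻¹ : Rˣ) : R) * _ = _
  rw [fDinvg_mul_darboux, Units.inv_mul, Derivation.map_one_eq_zero, zero_mul, fDinvg_zero_right,
    sub_zero, one_mul]

theorem darboux_ψ_succ_mul (hP : P.IsFor L u Ψ) (j : ℕ) :
    fDinvg 1 ((P.darboux u).ψ (j + 1)) * (PDO.darboux u : PDO R) =
      fDinvg 1 (P.ψ j) - ofFun (P.Ω 0 j * ((u⁻¹ : Rˣ) : R)) := by
  show fDinvg 1 (-(((u⁻¹ : Rˣ) : R) * P.Ω 0 j)) * _ = _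
  have h : (-(((u⁻¹ : Rˣ) : R) * P.Ω 0 j) * (u : R)) = -P.Ω 0 j := by
    linear_combination (-P.Ω 0 j) * u.inv_mul
  rw [fDinvg_mul_darboux, h, map_neg, hP.deriv_Ω, hP.φ_zero, mul_neg, one_mul, mul_comm _ (P.Ω 0 j),
    ofFun_neg, neg_mul, fDinvg_neg_right, show (u : R) * P.ψ j * ((u⁻¹ : Rˣ) : R) = P.ψ j by
      linear_combination P.ψ j * u.mul_inv]
  abel

/-- The transformed iterates are iterates of the transformed Lax operator. -/
theorem darboux (hP : P.IsFor L u Ψ) (hL : L.neg = fDinvg (u : R) Ψ) :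
    (P.darboux u).IsFor
      ((PDO.darboux u : PDO R) * L * (((PDO.darboux u)⁻¹ : (PDO R)ˣ) : PDO R))
      (darbouxApply u (P.φ 1)) ((u⁻¹ : Rˣ) : R) := by
  have hu0 : fDinvg (u : R) = fDinvg (P.φ 0) := by rw [hP.φ_zero]
  -- the operator `L T⁻¹` applied to the transformed eigenfunctions
  have hLφ : ∀ i, (L * ((((PDO.darboux u)⁻¹ : (PDO R)ˣ) : PDO R) *
      fDinvg ((P.darboux u).φ i) 1)).neg = fDinvg (P.φ (i + 2)) 1 -
        fDinvg (P.φ 1) (((u⁻¹ : Rˣ) : R) * P.φ (i + 1)) - fDinvg (u : R) ((P.darboux u).Ω i 1) := by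
    intro i
    rw [darboux_inv_mul_φ, mul_sub, neg_part_sub, hP.neg_mul_φ hL, hu0, hP.neg_mul_φ hL, ← hu0]
    show _ = _ - fDinvg (u : R) (P.Ω (i + 1) 0 - ((u⁻¹ : Rˣ) : R) * P.φ (i + 1) * P.Ω 0 0)
    rw [fDinvg_sub_right, mul_one, mul_comm (P.Ω 0 0)]
    abel
  have hLT : (L * (((PDO.darboux u)⁻¹ : (PDO R)ˣ) : PDO R)).neg =
      fDinvg (P.φ 1) ((u⁻¹ : Rˣ) : R) - fDinvg (u : R) (P.Ω 0 0 * ((u⁻¹ : Rˣ) : R)) := by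
    rw [darboux_inv, hu0, hP.neg_mul_φ hL, ← hu0]
  refine isFor_of_neg rfl rfl ?_ ?_ ?_ ?_
  · rintro i (_ | j)
    · show (((u⁻¹ : Rˣ) : R) * P.φ (i + 1))′ = _
      rw [darboux_φ_antideriv, mul_comm]
      rfl
    · show (P.Ω (i + 1) j - ((u⁻¹ : Rˣ) : R) * P.φ (i + 1) * P.Ω 0 j)′ =
        (P.darboux u).φ i * (-(((u⁻¹ : Rˣ) : R) * P.Ω 0 j))
      rw [map_sub, Derivation.leibniz, darboux_φ_antideriv, hP.deriv_Ω, hP.deriv_Ω, hP.φ_zero]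
      simp only [smul_eq_mul]
      linear_combination (-P.φ (i + 1) * P.ψ j) * u.inv_mul
  · intro i
    have h := hLφ i
    rw [mul_assoc, mul_assoc, neg_isDiff_mul (isDiff_darboux u), h, mul_sub, mul_sub,
      neg_part_sub, neg_part_sub]
    -- The term of `hLφ` with left factor Φ is lost because T(Φ) = 0.
    simp only [neg_darboux_mul_fDinvg, darbouxApply_self, fDinvg_zero_left, sub_zero]
    rfl
  · rintro (_ | j)
    · rw [← mul_assoc, ← mul_assoc, darboux_ψ_zero_mul, mul_assoc, neg_ofFun_mul, hLT, mul_sub,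
        ofFun_mul_fDinvg, ofFun_mul_fDinvg, Units.inv_mul]
      show _ = fDinvg 1 (-(((u⁻¹ : Rˣ) : R) * P.Ω 0 0)) + fDinvg (((u⁻¹ : Rˣ) : R) * P.φ 1) _
      rw [fDinvg_neg_right, mul_comm (P.Ω 0 0)]
      abel
    -- As T⁻¹ = Φ D⁻¹ Φ⁻¹ and Φ = φ₀, this is `neg_ψ_mul_φ` at i = 0 followed by multiplication by
    -- Φ⁻¹.
    · have hc : (fDinvg 1 (P.ψ j) * L * (((PDO.darboux u)⁻¹ : (PDO R)ˣ) : PDO R)).neg =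
          (fDinvg (P.Ω 1 j) 1 - fDinvg 1 (P.Ω 0 (j + 1)) - fDinvg (P.Ω 0 j) (P.Ω 0 0)) *
            ofFun ((u⁻¹ : Rˣ) : R) := by
        rw [← hP.neg_ψ_mul_φ hL, ← neg_mul_ofFun, hP.φ_zero, darboux_inv, mul_assoc _ (fDinvg _ 1),
          fDinvg_mul_ofFun, one_mul]
      rw [← mul_assoc, ← mul_assoc, hP.darboux_ψ_succ_mul, sub_mul, sub_mul, neg_part_sub, hc,
        mul_assoc (ofFun _), neg_ofFun_mul, hLT]
      show _ = fDinvg 1 (-(((u⁻¹ : Rˣ) : R) * P.Ω 0 (j + 1))) +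
        fDinvg (P.Ω 1 j - ((u⁻¹ : Rˣ) : R) * P.φ 1 * P.Ω 0 j) _
      simp only [sub_mul, mul_sub, fDinvg_mul_ofFun, ofFun_mul_fDinvg, fDinvg_sub_left,
        fDinvg_neg_right, one_mul, mul_assoc, Units.inv_mul, mul_one]
      rw [mul_comm (P.Ω 0 (j + 1)), mul_left_comm (P.Ω 0 j), mul_comm (P.Ω 0 j) (P.φ 1)]
      abel
  · rintro i (_ | j)
    · rw [← mul_assoc, ← mul_assoc, darboux_ψ_zero_mul, mul_assoc, mul_assoc, neg_ofFun_mul, hLφ]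
      simp only [mul_sub, ofFun_mul_fDinvg, Units.inv_mul]
      show _ = fDinvg (((u⁻¹ : Rˣ) : R) * P.φ (i + 2)) 1 - _ -
        fDinvg (((u⁻¹ : Rˣ) : R) * P.φ 1) (((u⁻¹ : Rˣ) : R) * P.φ (i + 1))
      abel
    · rw [← mul_assoc, ← mul_assoc, hP.darboux_ψ_succ_mul, sub_mul, sub_mul, sub_mul, neg_part_sub,
        mul_assoc _ (((PDO.darboux u)⁻¹ : (PDO R)ˣ) : PDO R), mul_assoc (ofFun _),
        mul_assoc (ofFun _), neg_ofFun_mul, mul_assoc L, hLφ, darboux_inv_mul_φ, mul_sub,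
        neg_part_sub,
        hP.neg_ψ_mul_φ hL]
      have h0 : (fDinvg 1 (P.ψ j) * L * fDinvg (u : R) (((u⁻¹ : Rˣ) : R) * P.φ (i + 1))).neg =
          (fDinvg (P.Ω 1 j) 1 - fDinvg 1 (P.Ω 0 (j + 1)) - fDinvg (P.Ω 0 j) (P.Ω 0 0)) *
            ofFun (((u⁻¹ : Rˣ) : R) * P.φ (i + 1)) := by
        rw [← hP.neg_ψ_mul_φ hL, ← neg_mul_ofFun, hP.φ_zero, mul_assoc _ (fDinvg _ 1),
          fDinvg_mul_ofFun, one_mul]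
      rw [h0]
      show _ = fDinvg (P.Ω (i + 2) j - ((u⁻¹ : Rˣ) : R) * P.φ (i + 2) * P.Ω 0 j) 1 -
        fDinvg 1 (P.Ω (i + 1) (j + 1) - ((u⁻¹ : Rˣ) : R) * P.φ (i + 1) * P.Ω 0 (j + 1)) -
        fDinvg (P.Ω 1 j - ((u⁻¹ : Rˣ) : R) * P.φ 1 * P.Ω 0 j) (((u⁻¹ : Rˣ) : R) * P.φ (i + 1))
      have h1 : (P.darboux u).Ω i 1 =
          P.Ω (i + 1) 0 - ((u⁻¹ : Rˣ) : R) * P.φ (i + 1) * P.Ω 0 0 := rfl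
      rw [h1]
      simp only [sub_mul, mul_sub, fDinvg_mul_ofFun, ofFun_mul_fDinvg, fDinvg_sub_left,
        fDinvg_sub_right, one_mul, mul_assoc, Units.inv_mul, mul_one]
      rw [mul_comm (P.Ω 0 j) (((u⁻¹ : Rˣ) : R) * _), mul_comm (P.Ω 0 j) (((u⁻¹ : Rˣ) : R) * _)]
      simp only [mul_assoc, mul_comm]
      abel

end Darboux

end IsFor

end Iterates

/-! ### Freedom in the integration constants, by generating series -/

namespace PDO

variable {R : Type*} [CommRing R] [Differential R]

theorem posApply_add (A : PDO R) (f g : R) :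
    A.posApply (f + g) = A.posApply f + A.posApply g := by
  simp only [posApply_eq_coeff, ofFun_add, mul_add, coeff_add]

theorem posApply_const_mul (A : PDO R) {c : R} (hc : c′ = 0) (f : R) :
    A.posApply (c * f) = c * A.posApply f := by
  rw [posApply_eq_coeff, posApply_eq_coeff, ← ofFun_mul_ofFun, ← mul_assoc,
    ← ofFun_mul_comm_of_deriv_eq_zero hc, mul_assoc, coeff_ofFun_mul]

theorem posAdjApply_add (A : PDO R) (f g : R) :
    A.posAdjApply (f + g) = A.posAdjApply f + A.posAdjApply g := by
  simp only [posAdjApply_eq_coeff, ofFun_add, mul_add, add_mul, coeff_add]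

theorem posAdjApply_const_mul (A : PDO R) {c : R} (hc : c′ = 0) (f : R) :
    A.posAdjApply (c * f) = c * A.posAdjApply f := by
  rw [posAdjApply_eq_coeff, posAdjApply_eq_coeff, ← ofFun_mul_ofFun, ← mul_assoc,
    ← ofFun_mul_comm_of_deriv_eq_zero hc, mul_assoc, mul_assoc, coeff_ofFun_mul, mul_assoc]

end PDO

namespace PowerSeries

open PDO

variable {R : Type*} [CommRing R] [Differential R]

/-- The bilinear pairing `(F, G) ↦ F A G` of power series of functions, for an operator `A`. -/
noncomputable def pairing (A : PDO R) (F G : PowerSeries R) : PowerSeries (PDO R) :=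
  map ofFunHom F * C A * map ofFunHom G

theorem coeff_pairing (A : PDO R) (F G : PowerSeries R) (n : ℕ) :
    coeff n (pairing A F G) = ∑ p ∈ Finset.HasAntidiagonal.antidiagonal n,
      ofFun (coeff p.1 F) * A * ofFun (coeff p.2 G) := by
  rw [pairing, coeff_mul]
  refine Finset.sum_congr rfl fun p _ => ?_
  rw [coeff_mul_C]
  rfl

theorem map_ofFunHom_commute {a : PowerSeries R} (ha : ∀ n, (coeff n a)′ = 0)
    (Y : PowerSeries (PDO R)) :
    map ofFunHom a * Y = Y * map ofFunHom a := by
  ext1 n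
  rw [coeff_mul, coeff_mul, ← Finset.Nat.sum_antidiagonal_swap]
  refine Finset.sum_congr rfl fun p _ => ?_
  exact ofFun_mul_comm_of_deriv_eq_zero (ha _) _

theorem pairing_mul (A : PDO R) {a b : PowerSeries R}
    (hb : ∀ n, (coeff n b)′ = 0) (F G : PowerSeries R) :
    pairing A (a * F) (b * G) = map ofFunHom (a * b) * pairing A F G := by
  have h := map_ofFunHom_commute hb
    (map ofFunHom F * C A)
  simp only [pairing, map_mul]
  rw [mul_assoc (map ofFunHom a), mul_assoc (map ofFunHom a),
    mul_assoc (map ofFunHom a), ← mul_assoc _ (map ofFunHom b), ← h]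
  simp only [mul_assoc]

theorem pairing_add_left (A : PDO R) (F F' G : PowerSeries R) :
    pairing A (F + F') G = pairing A F G + pairing A F' G := by
  simp only [pairing, map_add, add_mul]

theorem pairing_add_right (A : PDO R) (F G G' : PowerSeries R) :
    pairing A F (G + G') = pairing A F G + pairing A F G' := by
  simp only [pairing, map_add, mul_add]

end PowerSeries

section Recursion

open PowerSeries

variable {R : Type*} [CommRing R] [Differential R]

/-- The Euler derivation `z d/dz` of power series. -/
noncomputable def eulerDer (F : PowerSeries R) : PowerSeries R :=
  PowerSeries.mk fun n => (n : R) * coeff n F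

theorem eulerDer_mul (F G : PowerSeries R) :
    eulerDer (F * G) = eulerDer F * G + F * eulerDer G := by
  ext n
  simp only [eulerDer, coeff_mk, map_add, coeff_mul, Finset.mul_sum, ← Finset.sum_add_distrib]
  refine Finset.sum_congr rfl fun p hp => ?_
  rw [← Finset.HasAntidiagonal.mem_antidiagonal.mp hp]
  push_cast
  ring

theorem eulerDer_one : eulerDer (1 : PowerSeries R) = 0 := by
  ext n
  simp only [eulerDer, coeff_mk, coeff_one, map_zero]
  split_ifs with h <;> simp [h]

theorem deriv_coeff_mul_eq_zero {a b : PowerSeries R} (ha : ∀ n, (coeff n a)′ = 0)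
    (hb : ∀ n, (coeff n b)′ = 0) (n : ℕ) : (coeff n (a * b))′ = 0 := by
  rw [coeff_mul, map_sum]
  refine Finset.sum_eq_zero fun p _ => ?_
  rw [Derivation.leibniz, ha, hb, smul_zero, smul_zero, add_zero]

theorem deriv_coeff_eulerDer {a : PowerSeries R} (ha : ∀ n, (coeff n a)′ = 0) (n : ℕ) :
    (coeff n (eulerDer a))′ = 0 := by
  rw [eulerDer, coeff_mk, ← nsmul_eq_mul, map_nsmul, ha, smul_zero]

/-- Two sequences obtained by the same recursion with different integration constants differ by a
power series with constant coefficients. -/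
theorem exists_gauge {Λ : R → R} (hadd : ∀ f g, Λ (f + g) = Λ f + Λ g)
    (hmul : ∀ c f : R, c′ = 0 → Λ (c * f) = c * Λ f) {Φ Ψ : R} {f g ω w : ℕ → R}
    (hf0 : f 0 = Φ) (hg0 : g 0 = Φ) (hf : ∀ n, f (n + 1) = Λ (f n) + Φ * ω n)
    (hg : ∀ n, g (n + 1) = Λ (g n) + Φ * w n) (hω : ∀ n, (ω n)′ = f n * Ψ)
    (hw : ∀ n, (w n)′ = g n * Ψ) :
    ∃ a : PowerSeries R, (∀ n, (coeff n a)′ = 0) ∧ coeff 0 a = 1 ∧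
      a * (1 + X * PowerSeries.mk ω) = 1 + X * PowerSeries.mk w ∧
      PowerSeries.mk g = a * PowerSeries.mk f := by
  have hu : constantCoeff (1 + X * PowerSeries.mk ω) = ((1 : Rˣ) : R) := by simp
  -- If g = a f with constant a, the two recursions force a (1 + zω) = 1 + zw. This is solved for a
  -- first; that its coefficients are constants remains to be shown.
  set a := (1 + X * PowerSeries.mk w) * invOfUnit (1 + X * PowerSeries.mk ω) 1 with ha
  have h1 : a * (1 + X * PowerSeries.mk ω) = 1 + X * PowerSeries.mk w := by
    rw [ha, mul_assoc, mul_comm (invOfUnit _ _), mul_invOfUnit _ _ hu, mul_one]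
  clear_value a
  have ha0 : coeff 0 a = 1 := by
    have h := congrArg (coeff 0) h1
    simpa [coeff_zero_eq_constantCoeff] using h
  have hsucc : ∀ n, coeff (n + 1) a = w n - ∑ p ∈ Finset.HasAntidiagonal.antidiagonal n,
      coeff p.1 a * ω p.2 := by
    intro n
    have h := congrArg (coeff (n + 1)) h1
    rw [mul_add, mul_one, mul_left_comm, map_add, map_add, coeff_succ_X_mul, coeff_succ_X_mul,
      coeff_mul, coeff_one, if_neg (by omega)] at h
    simp only [coeff_mk] at h
    linear_combination h
  let ΛH : R →+ R := AddMonoidHom.mk' Λ hadd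
  -- Constancy of the next coefficient of a follows from the formula for g at n, since w n and the
  -- convolution of a with ω then have equal derivatives. Conversely, the formula for g at n + 1
  -- needs the earlier constants to commute with Λ.
  have key : ∀ n, ∀ m ≤ n, (coeff m a)′ = 0 ∧
      g m = ∑ p ∈ Finset.HasAntidiagonal.antidiagonal m, coeff p.1 a * f p.2 := by
    intro n
    induction n with
    | zero =>
      intro m hm
      obtain rfl : m = 0 := by omega
      rw [ha0, hg0]
      simp [ha0, hf0]
    | succ n ih =>
      intro m hm
      rcases Nat.lt_or_ge m (n + 1) with h | h
      · exact ih m (by omega)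
      obtain rfl : m = n + 1 := by omega
      have hle : ∀ p ∈ Finset.HasAntidiagonal.antidiagonal n, (coeff p.1 a)′ = 0 := fun p hp =>
        (ih p.1 (by have := Finset.HasAntidiagonal.mem_antidiagonal.mp hp; omega)).1
      refine ⟨?_, ?_⟩
      · rw [hsucc, map_sub, map_sum, hw, (ih n le_rfl).2, Finset.sum_mul, sub_eq_zero]
        refine Finset.sum_congr rfl fun p hp => ?_
        rw [Derivation.leibniz, hle p hp, hω, smul_zero, add_zero, smul_eq_mul, mul_assoc]
      · have hΛ : Λ (g n) = ∑ p ∈ Finset.HasAntidiagonal.antidiagonal n,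
            coeff p.1 a * Λ (f p.2) := by
          rw [(ih n le_rfl).2]
          refine (map_sum ΛH _ _).trans (Finset.sum_congr rfl fun p hp => ?_)
          exact hmul _ _ (hle p hp)
        rw [hg, hΛ, Finset.Nat.sum_antidiagonal_succ']
        simp only [hf, mul_add, Finset.sum_add_distrib, hf0, hsucc n]
        rw [sub_mul, Finset.sum_mul]
        have h3 : ∀ p ∈ Finset.HasAntidiagonal.antidiagonal n,
            coeff p.1 a * (Φ * ω p.2) = coeff p.1 a * ω p.2 * Φ := fun p _ => by ring
        rw [Finset.sum_congr rfl h3]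
        ring
  refine ⟨a, fun n => (key n n le_rfl).1, ha0, h1, ?_⟩
  ext n
  rw [coeff_mk, (key n n le_rfl).2, coeff_mul]
  simp only [coeff_mk]

end Recursion

namespace Iterates

open PDO

variable {R : Type*} [CommRing R] [Differential R] {L : PDO R} {Φ Ψ : R} {P Q : Iterates R}

/-- The generating function of the boundary terms `B(φᵢ, ψⱼ)`. -/
noncomputable def boundarySeries (L : PDO R) (P : Iterates R) : PowerSeries R :=
  PowerSeries.mk fun n => (PowerSeries.coeff n (PowerSeries.C (D (-1)) *
    PowerSeries.pairing L (PowerSeries.mk P.ψ)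
    (PowerSeries.mk P.φ))).coeff 0

namespace IsFor

theorem coeff_boundarySeries (L : PDO R) (P : Iterates R) (n : ℕ) :
    PowerSeries.coeff n (boundarySeries L P) = ∑ p ∈ Finset.HasAntidiagonal.antidiagonal n,
      L.boundary (P.φ p.1) (P.ψ p.2) := by
  let ev : PDO R →+ R := AddMonoidHom.mk' (fun A => A.coeff 0) fun _ _ => rfl
  rw [boundarySeries, PowerSeries.coeff_mk, PowerSeries.coeff_C_mul, PowerSeries.coeff_pairing,
    Finset.mul_sum]
  refine (map_sum ev _ _).trans ?_
  rw [← Finset.Nat.sum_antidiagonal_swap]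
  refine Finset.sum_congr rfl fun p _ => ?_
  simp only [PowerSeries.coeff_mk, boundary_eq_coeff, mul_assoc]
  rfl

/-- Summing `parts` over i + j = n telescopes to Ω_{n+1,0} - Ω_{0,n+1}. Only the border values of Ω
survive, and the quadratic term completes the product. -/
theorem one_add_mul_one_sub (hP : P.IsFor L Φ Ψ) :
    (1 + PowerSeries.X * PowerSeries.mk fun n =>
    P.Ω n 0) * (1 + PowerSeries.X * PowerSeries.mk fun n => -P.Ω 0 n) =
      1 + PowerSeries.X * (PowerSeries.X * boundarySeries L P) := by
  have h : (PowerSeries.mk fun n => P.Ω n 0) + (PowerSeries.mk fun n => -P.Ω 0 n) +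
      PowerSeries.X * ((PowerSeries.mk fun n => P.Ω n 0) * (PowerSeries.mk fun n => -P.Ω 0 n)) =
        PowerSeries.X * boundarySeries L P := by
    ext n
    cases n with
    | zero => simp
    | succ n =>
      rw [map_add, map_add, PowerSeries.coeff_succ_X_mul, PowerSeries.coeff_succ_X_mul,
        coeff_boundarySeries, PowerSeries.coeff_mul]
      simp only [PowerSeries.coeff_mk]
      have h1 := Finset.Nat.sum_antidiagonal_succ (n := n) (f := fun p => P.Ω p.1 p.2)
      have h2 := Finset.Nat.sum_antidiagonal_succ' (n := n) (f := fun p => P.Ω p.1 p.2)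
      have h3 : ∑ p ∈ Finset.HasAntidiagonal.antidiagonal n, L.boundary (P.φ p.1) (P.ψ p.2) =
          ∑ p ∈ Finset.HasAntidiagonal.antidiagonal n, (P.Ω (p.1 + 1) p.2 - P.Ω p.1 (p.2 + 1) -
            P.Ω p.1 0 * P.Ω 0 p.2) :=
        Finset.sum_congr rfl fun p _ => by linear_combination -hP.parts p.1 p.2
      rw [h3, Finset.sum_sub_distrib, Finset.sum_sub_distrib]
      simp only [mul_neg, Finset.sum_neg_distrib]
      linear_combination h1 - h2
  linear_combination PowerSeries.X * h

/-- Two admissible choices of the integration constants differ by a power series with constant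
coefficients. -/
theorem exists_gauge (hP : P.IsFor L Φ Ψ) (hQ : Q.IsFor L Φ Ψ) :
    ∃ a b : PowerSeries R, (∀ n, (PowerSeries.coeff n a)′ = 0) ∧ (∀ n,
    (PowerSeries.coeff n b)′ = 0) ∧ a * b = 1 ∧
      PowerSeries.mk Q.φ = a * PowerSeries.mk P.φ ∧
      PowerSeries.mk Q.ψ = b * PowerSeries.mk P.ψ := by
  obtain ⟨a, ha, -, ha1, haφ⟩ := _root_.exists_gauge (Λ := L.posApply) (posApply_add L)
    (fun c f hc => posApply_const_mul L hc f) hP.φ_zero hQ.φ_zero hP.φ_succ hQ.φ_succ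
    (fun n => by rw [hP.deriv_Ω, hP.ψ_zero]) (fun n => by rw [hQ.deriv_Ω, hQ.ψ_zero])
  obtain ⟨b, hb, -, hb1, hbψ⟩ := _root_.exists_gauge (Λ := L.posAdjApply) (Ψ := -Φ)
    (posAdjApply_add L) (fun c f hc => posAdjApply_const_mul L hc f) hP.ψ_zero hQ.ψ_zero
    (ω := fun n => -P.Ω 0 n) (w := fun n => -Q.Ω 0 n)
    (fun n => by rw [hP.ψ_succ]; ring) (fun n => by rw [hQ.ψ_succ]; ring)
    (fun n => by rw [map_neg, hP.deriv_Ω, hP.φ_zero]; ring)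
    (fun n => by rw [map_neg, hQ.deriv_Ω, hQ.φ_zero]; ring)
  refine ⟨a, b, ha, hb, ?_, haφ, hbψ⟩
  -- The boundary term is bilinear over constants, so both gauge factors come out.
  have hB : boundarySeries L Q = a * b * boundarySeries L P := by
    let ev : PDO R →+ R := AddMonoidHom.mk' (fun A => A.coeff 0) fun _ _ => rfl
    ext n
    rw [boundarySeries, PowerSeries.coeff_mk, haφ, hbψ, PowerSeries.pairing_mul L ha,
      PowerSeries.coeff_C_mul,
      PowerSeries.coeff_mul, PowerSeries.coeff_mul, Finset.mul_sum]
    refine (map_sum ev _ _).trans (Finset.sum_congr rfl fun p _ => ?_)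
    have hc := ofFun_mul_comm_of_deriv_eq_zero (deriv_coeff_mul_eq_zero hb ha p.1) (D (-1))
    show (D (-1) * (ofFun (PowerSeries.coeff p.1 (b * a)) * _)).coeff 0 = _
    rw [← mul_assoc, ← hc, mul_assoc, coeff_ofFun_mul, mul_comm b, boundarySeries,
      PowerSeries.coeff_mk,
      PowerSeries.coeff_C_mul]
  have h1 := hP.one_add_mul_one_sub
  have h2 := hQ.one_add_mul_one_sub
  rw [hB] at h2
  -- With B the boundary series of P, the product of border series for Q equals both ab(1 + z²B), by
  -- the gauge relations, and 1 + z²abB, by `hB`. Hence ab = 1.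
  linear_combination h2 + (-(a * b)) * h1 + (1 + PowerSeries.X * PowerSeries.mk fun n =>
    -Q.Ω 0 n) * ha1 +
    (a * (1 + PowerSeries.X * PowerSeries.mk fun n => P.Ω n 0)) * hb1

theorem neg_pow_eq_coeff (hP : P.IsFor L Φ Ψ) (hL : L.neg = fDinvg Φ Ψ) (n : ℕ) :
    (L ^ (n + 1)).neg =
      PowerSeries.coeff n (PowerSeries.pairing (D (-1)) (PowerSeries.mk P.φ) (PowerSeries.mk P.ψ))
      := by
  rw [hP.neg_pow hL, PowerSeries.coeff_pairing, ← Finset.Nat.sum_antidiagonal_swap]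
  simp only [Prod.fst_swap, Prod.snd_swap, PowerSeries.coeff_mk]
  rw [Finset.Nat.sum_antidiagonal_eq_sum_range_succ
    (fun j i => ofFun (P.φ i) * D (-1) * ofFun (P.ψ j))]
  rfl

variable [Algebra ℚ R]

/-- For i + j = n the weight j - n/2 is (j - i)/2, and z d/dz on the two generating series produces
the factors j and i. -/
theorem X_succ_eq_coeff (P : Iterates R) (n : ℕ) :
    P.X (n + 1) = ofFun (algebraMap ℚ R (1 / 2)) *
      PowerSeries.coeff n (PowerSeries.pairing (D (-1)) (PowerSeries.mk P.φ) (eulerDer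
      (PowerSeries.mk P.ψ)) -
        PowerSeries.pairing (D (-1)) (eulerDer (PowerSeries.mk P.φ)) (PowerSeries.mk P.ψ)) := by
  rw [map_sub, PowerSeries.coeff_pairing, PowerSeries.coeff_pairing, ← Finset.sum_sub_distrib,
    ← Finset.Nat.sum_antidiagonal_swap, Finset.mul_sum]
  simp only [Prod.fst_swap, Prod.snd_swap, PowerSeries.coeff_mk, eulerDer]
  rw [Finset.Nat.sum_antidiagonal_eq_sum_range_succ
    (fun j i => ofFun (algebraMap ℚ R (1 / 2)) *
      (ofFun (P.φ i) * D (-1) * ofFun ((j : R) * P.ψ j) -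
        ofFun ((i : R) * P.φ i) * D (-1) * ofFun (P.ψ j))), Iterates.X]
  refine Finset.sum_congr rfl fun j hj => ?_
  have hj' : j ≤ n := by simpa [Nat.lt_succ_iff] using hj
  have hn : (n : ℚ) = ((n - j : ℕ) : ℚ) + j := by rw [Nat.cast_sub hj']; ring
  have hc : ((j : R))′ = 0 := by
    rw [← nsmul_one, map_nsmul, Derivation.map_one_eq_zero, smul_zero]
  have h1 : fDinvg (P.φ (n - j)) ((j : R) * P.ψ j) = fDinvg ((j : R) * P.φ (n - j)) (P.ψ j) := by
    rw [fDinvg, ← ofFun_mul_ofFun, ← mul_assoc, ← ofFun_mul_comm_of_deriv_eq_zero hc, ← mul_assoc,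
      ofFun_mul_ofFun, fDinvg]
  show _ = _ * (fDinvg _ _ - fDinvg _ _)
  rw [h1, ← fDinvg_sub_left, ofFun_mul_fDinvg, ofFun_mul_fDinvg, ← sub_mul, ← mul_assoc,
    show n + 1 - 1 - j = n - j by omega]
  congr 2
  rw [← map_natCast (algebraMap ℚ R), ← map_natCast (algebraMap ℚ R), ← map_sub, ← map_mul]
  congr 1
  push_cast
  rw [hn]
  ring

/-- The dependence of `X⁽¹⁾_K` on the integration constants. -/
theorem exists_X_eq (hP : P.IsFor L Φ Ψ) (hL : L.neg = fDinvg Φ Ψ) (hQ : Q.IsFor L Φ Ψ) :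
    ∃ d : ℕ → R, (∀ n, (d n)′ = 0) ∧ ∀ K, Q.X K = P.X K +
      ∑ j ∈ Finset.Icc 1 (K - 1), ofFun (d (K - j)) * (L ^ j).neg := by
  obtain ⟨a, b, ha, hb, hab, hφ, hψ⟩ := hP.exists_gauge hQ
  have hd : ∀ n, (PowerSeries.coeff n (a * eulerDer b))′ = 0 :=
    deriv_coeff_mul_eq_zero ha (deriv_coeff_eulerDer hb)
  refine ⟨fun n => PowerSeries.coeff n (a * eulerDer b), hd, fun K => ?_⟩
  cases K with
  | zero => simp [Iterates.X]
  | succ n =>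
    -- Obtained by applying z d/dz to ab = 1. The two extra terms below therefore coincide, and
    -- their sum cancels the factor 1/2.
    have hE : eulerDer a * b = -(a * eulerDer b) := by
      have h := eulerDer_mul a b
      rw [hab, eulerDer_one] at h
      linear_combination -h
    have h2 : PowerSeries.pairing (D (-1)) (a * PowerSeries.mk P.φ)
          (eulerDer (b * PowerSeries.mk P.ψ)) -
        PowerSeries.pairing (D (-1)) (eulerDer (a * PowerSeries.mk P.φ)) (b * PowerSeries.mk P.ψ) =
        (PowerSeries.pairing (D (-1)) (PowerSeries.mk P.φ) (eulerDer (PowerSeries.mk P.ψ)) -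
          PowerSeries.pairing (D (-1)) (eulerDer (PowerSeries.mk P.φ)) (PowerSeries.mk P.ψ)) +
        (2 : ℕ) • (PowerSeries.map ofFunHom (a * eulerDer b) *
          PowerSeries.pairing (D (-1)) (PowerSeries.mk P.φ) (PowerSeries.mk P.ψ)) := by
      rw [eulerDer_mul, eulerDer_mul, PowerSeries.pairing_add_left, PowerSeries.pairing_add_right,
        PowerSeries.pairing_mul _ (deriv_coeff_eulerDer hb), PowerSeries.pairing_mul _ hb,
        PowerSeries.pairing_mul _ hb, PowerSeries.pairing_mul _ hb,
        hab, hE, map_one, one_mul, one_mul, map_neg]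
      noncomm_ring
    rw [X_succ_eq_coeff, X_succ_eq_coeff, hφ, hψ, h2, map_add, mul_add, map_nsmul, nsmul_eq_mul,
      ← mul_assoc, show ofFun (algebraMap ℚ R (1 / 2)) * ((2 : ℕ) : PDO R) = 1 by
        rw [← map_natCast (ofFunHom (R := R))]
        show ofFun _ * ofFun _ = _
        rw [ofFun_mul_ofFun, ← map_natCast (algebraMap ℚ R), ← map_mul]
        norm_num [ofFun_one], one_mul]
    congr 1
    rw [PowerSeries.coeff_mul, Finset.Nat.sum_antidiagonal_eq_sum_range_succ_mk,
      Finset.sum_range_succ', ← Finset.sum_range_reflect]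
    -- The Euler derivation has no constant term, so the top power Lⁿ⁺¹ = Lᴷ does not occur.
    have h0 : PowerSeries.coeff 0 (a * eulerDer b) = 0 := by
      rw [PowerSeries.coeff_mul]
      simp [eulerDer]
    simp only [PowerSeries.coeff_map, h0, map_zero, zero_mul, add_zero, ← hP.neg_pow_eq_coeff hL]
    rw [show Finset.Icc 1 (n + 1 - 1) = Finset.Ico 1 (n + 1) by ext; simp,
      Finset.sum_Ico_eq_sum_range]
    refine Finset.sum_congr rfl fun j hj => ?_
    have hj' : j < n := by simpa using hj
    rw [show n - 1 - j + 1 = n + 1 - (1 + j) by omega,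
      show n - (n + 1 - (1 + j)) + 1 = 1 + j by omega]
    rfl

end IsFor

end Iterates

/-! ### Lax equations and the transformed solution of the hierarchy -/

namespace LaxSystem

open PDO

variable {R : Type*} [CommRing R] [Differential R]

theorem root_commute (S : LaxSystem R) (m n : ℕ) : S.root m * S.root n = S.root n * S.root m := by
  simp only [root, mul_assoc, Units.inv_mul_cancel_left]
  rw [← mul_assoc (D (m : ℤ)), ← mul_assoc (D (n : ℤ)), D_mul_D, D_mul_D, add_comm]

theorem root_mul_root (S : LaxSystem R) (m n : ℕ) : S.root m * S.root n = S.root (m + n) := by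
  simp only [root, mul_assoc, Units.inv_mul_cancel_left]
  rw [← mul_assoc (D (m : ℤ)), D_mul_D, Nat.cast_add]

theorem lax_pow (S : LaxSystem R) (r k : ℕ) : S.lax r ^ k = S.root (r * k) := by
  induction k with
  | zero =>
    rw [pow_zero, mul_zero, root, Nat.cast_zero, D_zero, mul_one, Units.mul_inv]
  | succ k ih => rw [pow_succ, ih, lax, root_mul_root, mul_add, mul_one]

namespace IsCKP

variable {T : KPTimes R} {r : ℕ} {S : LaxSystem R}

theorem flow_deriv (T : KPTimes R) {n : ℕ} (hn : 1 ≤ n) (f : R) : T.flow n (f′) =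
    (T.flow n f)′ := by
  rw [← T.flow_one, T.flow_comm n 1 hn le_rfl]

/-- The Lax equations. -/
theorem mapDer_root (hsato : ∀ n, 1 ≤ n →
      mapDer (T.flow n) (S.W : PDO R) = -((S.root n).neg * (S.W : PDO R)))
    {n : ℕ} (hn : 1 ≤ n) (m : ℕ) :
    mapDer (T.flow n) (S.root m) = -⁅(S.root n).neg, S.root m⁆ := by
  have h := mapDer_conj (flow_deriv T hn) S.W (N := -(S.root n).neg)
    ((hsato n hn).trans (neg_mul _ _).symm) (mapDer_D (T.flow n) (m : ℤ))
  rw [mul_zero, zero_mul, add_zero] at h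
  rw [root, h, Ring.lie_def, Ring.lie_def]
  noncomm_ring

end IsCKP

section Darboux

variable {T : KPTimes R} {r : ℕ} {S : LaxSystem R} {P : Iterates R} {u : Rˣ}

/-- The trailing D⁻¹ in W̃ = T W D⁻¹ commutes with Dⁿ and drops out; it is there only to make W̃ of
order zero. -/
theorem root_darboux (S : LaxSystem R) (u : Rˣ) (P : Iterates R) (n : ℕ) :
    (S.darboux u P).root n =
      (PDO.darboux u : PDO R) * S.root n * (((PDO.darboux u)⁻¹ : (PDO R)ˣ) : PDO R) := by
  simp only [root, darboux, Units.val_mul, mul_inv_rev, mul_assoc]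
  congr 2
  show D (-1) * (D (n : ℤ) * (D (- -1) * _)) = _
  rw [← mul_assoc (D (n : ℤ)), ← mul_assoc, D_mul_D, D_mul_D]
  congr 2
  ring

/-- The Darboux-Bäcklund transform of a solution of the constrained hierarchy is a solution. -/
theorem isCKP_darboux (hS : S.IsCKP T r) (hu : (u : R) = S.Φ)
    (hP : P.IsFor (S.lax r) S.Φ S.Ψ) : (S.darboux u P).IsCKP T r := by
  have hW : (S.W : PDO R).OrdLE 0 := hS.coeff_pos
  have hui : ∀ n, T.flow n ((u⁻¹ : Rˣ) : R) =
      -(((u⁻¹ : Rˣ) : R) * (((u⁻¹ : Rˣ) : R) * T.flow n u)) := fun n => by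
    have h := congrArg (T.flow n) u.inv_mul
    rw [Derivation.leibniz, Derivation.map_one_eq_zero] at h
    simp only [smul_eq_mul] at h
    linear_combination ((u⁻¹ : Rˣ) : R) * h - T.flow n ((u⁻¹ : Rˣ) : R) * u.inv_mul
  have hsato : ∀ n, 1 ≤ n → mapDer (T.flow n) ((S.darboux u P).W : PDO R) =
      -(((S.darboux u P).root n).neg * ((S.darboux u P).W : PDO R)) := by
    intro n hn
    have hδ := IsCKP.flow_deriv T hn
    show mapDer (T.flow n) ((PDO.darboux u : PDO R) * (S.W : PDO R) * D (-1)) =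
      -(_ * ((PDO.darboux u : PDO R) * (S.W : PDO R) * D (-1)))
    rw [root_darboux, neg_darboux_conj, mapDer_mul hδ, mapDer_mul hδ, mapDer_darboux u hδ, mapDer_D,
      hS.sato n hn, hu, hS.eigen n hn, ← hu]
    simp only [add_mul, mul_assoc, Units.inv_mul_cancel_left, mul_neg, neg_mul, mul_zero]
    abel
  have hconstr : ((S.darboux u P).lax r).neg =
      fDinvg (darbouxApply u (P.φ 1)) ((u⁻¹ : Rˣ) : R) := by
    have h0 : fDinvg (u : R) = fDinvg (P.φ 0) := by rw [hP.φ_zero, hu]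
    rw [lax, root_darboux, mul_assoc, neg_isDiff_mul (isDiff_darboux u), darboux_inv, h0,
      show S.root r = S.lax r from rfl, hP.neg_mul_φ hS.constraint, mul_sub, neg_part_sub, ← hu,
      neg_darboux_mul_fDinvg, neg_darboux_mul_fDinvg, darbouxApply_self, fDinvg_zero_left, sub_zero]
  -- The adjoint action is the residue of D⁻¹ Φ⁻¹ T A T⁻¹ = Φ⁻¹ A Φ D⁻¹ Φ⁻¹ with A = L^{n/r}, which
  -- is Φ⁻¹ A₊(Φ) Φ⁻¹.
  have hadj : ∀ n, 1 ≤ n → T.flow n ((u⁻¹ : Rˣ) : R) =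
      -((S.darboux u P).root n).posAdjApply ((u⁻¹ : Rˣ) : R) := by
    intro n hn
    have h : fDinvg (u : R) ((u⁻¹ : Rˣ) : R) = fDinvg (u : R) 1 * ofFun ((u⁻¹ : Rˣ) : R) := by
      rw [fDinvg_mul_ofFun, one_mul]
    rw [hui, ← coeff_neg_one_fDinvg_one_mul, root_darboux, ← mul_assoc (fDinvg 1 _),
      ← mul_assoc (fDinvg 1 _),
      show fDinvg 1 ((u⁻¹ : Rˣ) : R) * (PDO.darboux u : PDO R) = ofFun ((u⁻¹ : Rˣ) : R) from
        Iterates.IsFor.darboux_ψ_zero_mul P u, mul_assoc (ofFun _), coeff_ofFun_mul, darboux_inv, h,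
      ← mul_assoc (S.root n), coeff_neg_one_mul_ofFun, coeff_neg_one_mul_fDinvg_one, hu,
      hS.eigen n hn]
    ring
  refine ⟨?_, ?_, hsato, hconstr, ?_, hadj⟩
  · show ((PDO.darboux u : PDO R) * (S.W : PDO R) * D (-1)).coeff 0 = 1
    have h := (ordLE_darboux u).coeff_mul hW
    rw [coeff_mul_D, sub_neg_eq_add, add_comm, h, coeff_one_darboux, hS.coeff_zero, one_mul]
  · exact ((ordLE_darboux u).mul hW).mul (ordLE_D (-1))
  -- The equation for Φ̃ is extracted from the Lax equation ∂ₙL̃ = [(L̃^{n/r})₊, L̃]. In its purely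
  -- pseudo-differential part the terms with ∂ₙΨ̃ cancel by `hadj`, and the invertible Ψ̃ = Φ⁻¹ can
  -- be divided out.
  · intro n hn
    have hδ := IsCKP.flow_deriv T hn
    have h1 := congrArg neg (IsCKP.mapDer_root hsato hn r)
    have h2 : ⁅((S.darboux u P).root n).neg, (S.darboux u P).root r⁆ =
        -⁅((S.darboux u P).root n).pos, (S.darboux u P).root r⁆ := by
      rw [pos, Ring.lie_def, Ring.lie_def]
      have := (S.darboux u P).root_commute n r
      linear_combination (norm := noncomm_ring) this
    rw [h2, neg_neg, ← mapDer_neg_part, show (S.darboux u P).root r =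
      (S.darboux u P).lax r from rfl,
      hconstr, mapDer_fDinvg hδ, hadj n hn, Ring.lie_def, neg_part_sub,
      neg_isDiff_mul (isDiff_pos _), neg_mul_isDiff (isDiff_pos _), hconstr,
      neg_isDiff_mul_fDinvg (isDiff_pos _), neg_fDinvg_mul_isDiff (isDiff_pos _), posApply_pos,
      posAdjApply_pos, fDinvg_neg_right, ← sub_eq_add_neg, sub_left_inj, ← sub_eq_zero,
      ← fDinvg_sub_left] at h1
    exact sub_eq_zero.mp (fDinvg_eq_zero_left (u⁻¹).isUnit h1)

end Darboux

end LaxSystem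

/-! ### Constants, and the variation of Φ read off from that of L -/

namespace PDO

section Constants

variable {R : Type*} [CommRing R] [Differential R]

theorem D_mul_of_deriv_eq_zero {A : PDO R} (hA : ∀ n, (A.coeff n)′ = 0) (m : ℤ) :
    D m * A = A * D m := by
  ext s
  obtain ⟨M, hM⟩ := A.exists_bound (s - m)
  rw [coeff_mul_D, coeff_D_mul A m s (M + 1) (fun n hn => hM n (by push_cast at hn; omega)),
    Finset.sum_range_succ', Finset.sum_eq_zero fun j _ => by
      rw [dx_succ_in, hA, dx_zero_right, smul_zero]]
  simp [dx]

theorem D_natCast_mul_ofFun {f : R} (hf : (f′)′ = 0) (m : ℕ) :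
    D (m : ℤ) * ofFun f = ofFun f * D (m : ℤ) + m • (ofFun (f′) * D ((m : ℤ) - 1)) := by
  induction m with
  | zero => rw [Nat.cast_zero, D_zero, one_mul, mul_one, zero_smul, add_zero]
  | succ m ih =>
    have h1 : (D ((m + 1 : ℕ) : ℤ) : PDO R) = D (m : ℤ) * D 1 := by rw [D_mul_D]; rfl
    have h2 : (D (m : ℤ) : PDO R) = D ((m : ℤ) - 1) * D 1 := by rw [D_mul_D, sub_add_cancel]
    have h3 : D (m : ℤ) * ofFun (f′) = ofFun (f′) * D (m : ℤ) :=
      (ofFun_mul_comm_of_deriv_eq_zero hf _).symm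
    have h4 : (((m + 1 : ℕ) : ℤ) - 1) = m := by push_cast; ring
    rw [h4, h1, mul_assoc, D_one_mul_ofFun, mul_add, ← mul_assoc, ih, h3, add_mul, add_smul,
      one_smul, smul_mul_assoc, mul_assoc (ofFun (f′)), ← h2, mul_assoc, add_assoc]

theorem coeff_neg_two_fDinvg (f g : R) : (fDinvg f g).coeff (-2) = -(f * g′) := by
  rw [fDinvg, mul_assoc, coeff_ofFun_mul, coeff_D_neg_one_mul _ _ 2 fun n hn => if_neg (by omega)]
  simp [Finset.sum_range_succ, coeff_ofFun, dx]

/-- The logarithmic derivative of the variation of `Φ`, read off from the variation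
`x D⁻¹ Ψ - Φ D⁻¹ y` of `Φ D⁻¹ Ψ`. -/
def logVar (Φ Ψ : Rˣ) (Z : PDO R) : R :=
  (((Φ * Ψ)⁻¹ : Rˣ) * Z.coeff (-1))′ + ((Φ * Ψ)⁻¹ : Rˣ) * Z.coeff (-2) +
    ((Φ * Ψ)⁻¹ : Rˣ) * (((Φ * Ψ)⁻¹ : Rˣ) * (Φ * (Ψ : R)′ * Z.coeff (-1)))

theorem logVar_add (Φ Ψ : Rˣ) (Z Y : PDO R) :
    logVar Φ Ψ (Z + Y) = logVar Φ Ψ Z + logVar Φ Ψ Y := by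
  simp only [logVar, coeff_add, mul_add, map_add]
  ring

/-- Put x = Φξ and y = Ψη. The coefficient of D⁻¹ gives ξ - η and, after correction by it, that of
D⁻² gives η′; then ξ′ = (ξ - η)′ + η′. Division by ΦΨ is where both must be invertible. -/
theorem logVar_fDinvg (Φ Ψ : Rˣ) (x y : R) :
    logVar Φ Ψ (fDinvg x (Ψ : R) - fDinvg (Φ : R) y) = (((Φ⁻¹ : Rˣ) : R) * x)′ := by
  obtain ⟨ξ, rfl⟩ : ∃ ξ, x = Φ * ξ := ⟨((Φ⁻¹ : Rˣ) : R) * x, by rw [Units.mul_inv_cancel_left]⟩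
  obtain ⟨η, rfl⟩ : ∃ η, y = Ψ * η := ⟨((Ψ⁻¹ : Rˣ) : R) * y, by rw [Units.mul_inv_cancel_left]⟩
  have hw : (((Φ * Ψ)⁻¹ : Rˣ) : R) * (Φ * Ψ) = 1 := by
    rw [← Units.val_mul Φ, Units.inv_mul]
  have h1 : (fDinvg (Φ * ξ) (Ψ : R) - fDinvg (Φ : R) (Ψ * η)).coeff (-1) =
      Φ * Ψ * (ξ - η) := by
    rw [coeff_sub, coeff_fDinvg, coeff_fDinvg]
    ring
  have h2 : (fDinvg (Φ * ξ) (Ψ : R) - fDinvg (Φ : R) (Ψ * η)).coeff (-2) =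
      Φ * Ψ * η′ - Φ * (Ψ : R)′ * (ξ - η) := by
    rw [coeff_sub, coeff_neg_two_fDinvg, coeff_neg_two_fDinvg, Derivation.leibniz]
    simp only [smul_eq_mul]
    ring
  have h3 : (((Φ * Ψ)⁻¹ : Rˣ) : R) * (Φ * Ψ * (ξ - η)) = ξ - η := by
    linear_combination (ξ - η) * hw
  rw [logVar, h1, h2, h3, map_sub, Units.inv_mul_cancel_left]
  linear_combination (η′ + ((Φ * Ψ)⁻¹ : Rˣ) * (Φ : R) * (Ψ : R)′ * (ξ - η)) * hw

end Constants

theorem deriv_algebraMap_rat {R : Type*} [CommRing R] [Differential R] [Algebra ℚ R] (q : ℚ) :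
    (algebraMap ℚ R q)′ = 0 := by
  rw [Algebra.algebraMap_eq_smul_one, map_rat_smul, Derivation.map_one_eq_zero, smul_zero]

/-! ### Coefficientwise convergent series of operators -/

section Sums

variable {R : Type*} [CommRing R] [Differential R] [TopologicalSpace R]

/-- Coefficientwise convergence of a series of operators. -/
def HasCoeffSum (A : ℕ → PDO R) (B : PDO R) : Prop :=
  ∀ n, HasSum (fun l => (A l).coeff n) (B.coeff n)

theorem HasCoeffSum.neg_part {A : ℕ → PDO R} {B : PDO R} (h : HasCoeffSum A B) :
    HasCoeffSum (fun l => (A l).neg) B.neg := fun n => by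
  simp only [coeff_neg_part]
  split_ifs
  · exact h n
  · exact hasSum_zero

variable [IsTopologicalRing R]

theorem HasCoeffSum.add {A A' : ℕ → PDO R} {B B' : PDO R} (h : HasCoeffSum A B)
    (h' : HasCoeffSum A' B') : HasCoeffSum (fun l => A l + A' l) (B + B') :=
  fun n => (h n).add (h' n)

theorem HasCoeffSum.sub {A A' : ℕ → PDO R} {B B' : PDO R} (h : HasCoeffSum A B)
    (h' : HasCoeffSum A' B') : HasCoeffSum (fun l => A l - A' l) (B - B') := fun n => by
  simp only [coeff_sub]
  exact (h n).sub (h' n)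

theorem hasCoeffSum_ite (i : ℕ) (B : PDO R) : HasCoeffSum (fun l => if l = i then B else 0) B :=
  fun n => by
    convert hasSum_ite_eq i (B.coeff n) using 2 with l
    dsimp only
    split_ifs <;> rfl

theorem hasCoeffSum_fDinvg {f : ℕ → R} {s : R} (h : HasSum f s) (g : R) :
    HasCoeffSum (fun l => fDinvg (f l) g) (fDinvg s g) := fun n => by
  simp only [fDinvg, mul_assoc, coeff_ofFun_mul]
  exact h.mul_right _

theorem continuous_dx (hcont : Continuous fun f : R => f′) (j : ℕ) :
    Continuous fun f : R => dx j f := hcont.iterate j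

theorem hasSum_deriv (hcont : Continuous fun f : R => f′) {f : ℕ → R} {s : R} (h : HasSum f s) :
    HasSum (fun l => (f l)′) (s′) :=
  h.map (Differential.deriv : Derivation ℤ R R) hcont

theorem hasSum_dx (hcont : Continuous fun f : R => f′) (j : ℕ) {f : ℕ → R} {s : R}
    (h : HasSum f s) : HasSum (fun l => dx j (f l)) (dx j s) :=
  h.map (AddMonoidHom.mk' (dx j) (dx_add j)) (continuous_dx hcont j)

variable [T2Space R]

theorem HasCoeffSum.ordLE {A : ℕ → PDO R} {B : PDO R} (h : HasCoeffSum A B) {N : ℤ}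
    (hA : ∀ l, (A l).OrdLE N) : B.OrdLE N := fun n hn => by
  have h1 := h n
  simp only [hA _ n hn] at h1
  exact h1.unique hasSum_zero

/-- A common bound on the orders makes each coefficient of the product one fixed finite expression
in derivatives of coefficients, so continuity of ∂ suffices. -/
theorem HasCoeffSum.mul_left (hcont : Continuous fun f : R => f′) {A : ℕ → PDO R} {B : PDO R}
    (h : HasCoeffSum A B) {N : ℤ} (hA : ∀ l, (A l).OrdLE N) (C : PDO R) :
    HasCoeffSum (fun l => C * A l) (C * B) := fun s => by
  obtain ⟨NC, hC⟩ := C.bdd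
  obtain ⟨M, hM⟩ : ∃ M : ℕ, NC + N - s < M := ⟨(NC + N - s).toNat + 1, by omega⟩
  simp only [coeff_mul_eq_sum hC (hA _) s M hM, coeff_mul_eq_sum hC (h.ordLE hA) s M hM,
    zsmul_eq_mul]
  exact hasSum_sum fun i _ => hasSum_sum fun j _ =>
    ((hasSum_dx hcont j (h _)).mul_left _).mul_left _

theorem HasCoeffSum.mul_right {A : ℕ → PDO R} {B : PDO R}
    (h : HasCoeffSum A B) {N : ℤ} (hA : ∀ l, (A l).OrdLE N) (C : PDO R) :
    HasCoeffSum (fun l => A l * C) (B * C) := fun s => by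
  obtain ⟨NC, hC⟩ := C.bdd
  obtain ⟨M, hM⟩ : ∃ M : ℕ, N + NC - s < M := ⟨(N + NC - s).toNat + 1, by omega⟩
  simp only [coeff_mul_eq_sum (hA _) hC s M hM, coeff_mul_eq_sum (h.ordLE hA) hC s M hM,
    zsmul_eq_mul]
  exact hasSum_sum fun i _ => hasSum_sum fun j _ => ((h _).mul_right _).mul_left _

theorem HasCoeffSum.logVar (hcont : Continuous fun f : R => f′) {A : ℕ → PDO R} {B : PDO R}
    (h : HasCoeffSum A B) (Φ Ψ : Rˣ) :
    HasSum (fun l => logVar Φ Ψ (A l)) (logVar Φ Ψ B) :=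
  ((hasSum_deriv hcont ((h _).mul_left _)).add ((h _).mul_left _)).add
    ((((h _).mul_left _).mul_left _).mul_left _)

theorem negSum_eq {A : ℕ → PDO R} {B : PDO R} (h : HasCoeffSum (fun l => (A l).neg) B) :
    negSum A = B := by
  ext n
  show (if n < 0 then ∑' l, (A l).coeff n else 0) = _
  split_ifs with hn
  · have h1 := h n
    simp only [coeff_neg_part, if_pos hn] at h1
    exact h1.tsum_eq
  · exact (h.ordLE (fun l => ordLE_neg _) n (by omega)).symm

theorem hasCoeffSum_negSum {A : ℕ → PDO R} (h : ∀ n : ℤ, n < 0 → Summable fun l => (A l).coeff n) :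
    HasCoeffSum (fun l => (A l).neg) (negSum A) := fun n => by
  show HasSum _ (if n < 0 then ∑' l, (A l).coeff n else 0)
  simp only [coeff_neg_part]
  split_ifs with hn
  · exact (h n hn).hasSum
  · exact hasSum_zero

end Sums

end PDO

/-! ### The commutator of M Lᵏ with L -/

namespace LaxSystem

open PDO

variable {R : Type*} [CommRing R] [Differential R] [Algebra ℚ R]

/-- The commutator of the terms of `M Lᵏ` with `L`. -/
theorem orlov_lie (T : KPTimes R) {r : ℕ} (hr : 1 ≤ r) (S : LaxSystem R) {E : PDO R}
    (hE : mapDer (T.flow 1) E = 0) (k l : ℕ) :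
    ⁅S.orlov T r E l * S.lax r ^ k, S.lax r⁆ = if l = 1 then -S.lax r ^ k else 0 := by
  have key : ∀ A : PDO R, ⁅(S.W : PDO R) * A * ((S.W⁻¹ : (PDO R)ˣ) : PDO R) * S.lax r ^ k,
      S.lax r⁆ =
      (S.W : PDO R) * (A * D (r : ℤ) - D (r : ℤ) * A) * ((S.W⁻¹ : (PDO R)ˣ) : PDO R) *
        S.lax r ^ k := by
    intro A
    have h1 : S.lax r * ((S.W : PDO R) * A * ((S.W⁻¹ : (PDO R)ˣ) : PDO R)) =
        (S.W : PDO R) * (D (r : ℤ) * A) * ((S.W⁻¹ : (PDO R)ˣ) : PDO R) := by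
      simp only [lax, root, mul_assoc, Units.inv_mul_cancel_left]
    have h2 : (S.W : PDO R) * A * ((S.W⁻¹ : (PDO R)ˣ) : PDO R) * S.lax r =
        (S.W : PDO R) * (A * D (r : ℤ)) * ((S.W⁻¹ : (PDO R)ˣ) : PDO R) := by
      simp only [lax, root, mul_assoc, Units.inv_mul_cancel_left]
    rw [Ring.lie_def, mul_assoc, ← pow_succ, pow_succ', ← mul_assoc, ← mul_assoc, h1, h2,
      mul_sub, sub_mul, sub_mul]
  match l with
  | 0 =>
    have h : D (r : ℤ) * E = E * D (r : ℤ) := D_mul_of_deriv_eq_zero (fun n => by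
      have := congrArg (fun A : PDO R => A.coeff n) hE
      rwa [coeff_mapDer, T.flow_one] at this) _
    rw [orlov, key, h, sub_self, mul_zero, zero_mul, zero_mul, if_neg (by norm_num)]
  | l + 1 =>
    set f : R := (((l + 1 : ℕ) : ℚ) / r) • T.t (l + 1) with hf
    -- Only t₁ = x depends on x. Since [f D^{l+1-r}, Dʳ] = -r f′ Dˡ when f″ = 0, the single
    -- surviving commutator is -1, before dressing.
    have hf1 : f′ = if l = 0 then algebraMap ℚ R (1 / r) else 0 := by
      have h1 : (T.t (l + 1))′ = if 1 = l + 1 then 1 else 0 := by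
        rw [← T.flow_t 1 (l + 1) le_rfl (by omega), T.flow_one]
      rw [hf, map_rat_smul, h1]
      by_cases hl : l = 0
      · subst hl
        simp [Algebra.algebraMap_eq_smul_one]
      · rw [if_neg (by omega), if_neg hl, smul_zero]
    have hf2 : (f′)′ = 0 := by
      rw [hf1]
      split_ifs
      · exact deriv_algebraMap_rat _
      · exact map_zero _
    rw [orlov, key, monomial_eq, ← mul_assoc (D (r : ℤ)), D_natCast_mul_ofFun hf2, add_mul,
      mul_assoc (ofFun f), mul_assoc (ofFun f), D_mul_D, D_mul_D, add_comm ((r : ℤ)),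
      sub_add_cancel_left, smul_mul_assoc, mul_assoc (ofFun (f′)), D_mul_D, hf1]
    by_cases hl : l = 0
    · subst hl
      rw [if_pos rfl, if_pos rfl,
        show (r : ℤ) - 1 + (((0 + 1 : ℕ) : ℤ) - r) = 0 by push_cast; ring, D_zero, mul_one,
        nsmul_eq_mul, show ((r : ℕ) : PDO R) * ofFun (algebraMap ℚ R (1 / r)) = 1 by
          rw [← map_natCast (ofFunHom (R := R))]
          show ofFun _ * ofFun _ = _
          rw [ofFun_mul_ofFun, ← map_natCast (algebraMap ℚ R), ← map_mul,
            mul_one_div_cancel (by positivity), map_one, ofFun_one],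
        mul_neg, mul_one, neg_mul, neg_mul, Units.mul_inv, one_mul]
    · rw [if_neg hl, if_neg (by omega), ofFun_zero, zero_mul, smul_zero, neg_zero, mul_zero,
        zero_mul, zero_mul]

end LaxSystem

/-! ### The operators X and the variation they produce -/

namespace PDO

variable {R : Type*} [CommRing R] [Differential R] [Algebra ℚ R]

/-- Multiplication by a rational number, as an operator. -/
noncomputable def rat : ℚ →+* PDO R := ofFunHom.comp (algebraMap ℚ R)

theorem rat_apply (q : ℚ) : (rat q : PDO R) = ofFun (algebraMap ℚ R q) := rfl

theorem rat_mul_comm (q : ℚ) (A : PDO R) : rat q * A = A * rat q :=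
  ofFun_mul_comm_of_deriv_eq_zero (deriv_algebraMap_rat q) A

theorem rat_mul_fDinvg (q : ℚ) (f g : R) :
    rat q * fDinvg f g = fDinvg (algebraMap ℚ R q * f) g := ofFun_mul_fDinvg _ _ _

theorem rat_mul_fDinvg' (q : ℚ) (f g : R) :
    rat q * fDinvg f g = fDinvg f (algebraMap ℚ R q * g) := by
  rw [rat_mul_comm, rat_apply, fDinvg_mul_ofFun, mul_comm g]

/-- Summation by parts with the weights of `X⁽¹⁾_K`. -/
theorem sum_rat_mul_sub (a : ℕ → PDO R) (K : ℕ) :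
    ∑ j ∈ Finset.range K, rat ((j : ℚ) - ((K : ℚ) - 1) / 2) * (a (j + 1) - a j) =
      rat (((K : ℚ) - 1) / 2) * a K + rat (((K : ℚ) + 1) / 2) * a 0 -
        ∑ j ∈ Finset.range K, a j := by
  have h := Finset.sum_range_sub (fun j : ℕ => rat ((j : ℚ) - ((K : ℚ) + 1) / 2) * a j) K
  rw [show (K : ℚ) - ((K : ℚ) + 1) / 2 = ((K : ℚ) - 1) / 2 by ring,
    show ((0 : ℕ) : ℚ) - ((K : ℚ) + 1) / 2 = -(((K : ℚ) + 1) / 2) by push_cast; ring, map_neg,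
    neg_mul, sub_neg_eq_add] at h
  rw [← h, ← Finset.sum_sub_distrib]
  refine Finset.sum_congr rfl fun j _ => ?_
  rw [show (((j + 1 : ℕ) : ℚ)) - ((K : ℚ) + 1) / 2 = (j : ℚ) - ((K : ℚ) - 1) / 2 by push_cast; ring,
    show (j : ℚ) - ((K : ℚ) + 1) / 2 = ((j : ℚ) - ((K : ℚ) - 1) / 2) - 1 by ring]
  generalize (j : ℚ) - ((K : ℚ) - 1) / 2 = q
  rw [map_sub, map_one]
  noncomm_ring

theorem darbouxApply_add (u : Rˣ) (f g : R) :
    darbouxApply u (f + g) = darbouxApply u f + darbouxApply u g := by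
  simp only [darbouxApply, mul_add, map_add]

theorem darbouxApply_const_mul (u : Rˣ) {c : R} (hc : c′ = 0) (f : R) :
    darbouxApply u (c * f) = c * darbouxApply u f := by
  rw [darbouxApply, darbouxApply, mul_left_comm _ c, Derivation.leibniz, hc, smul_zero, add_zero,
    smul_eq_mul, mul_left_comm]

theorem darbouxApply_sum (u : Rˣ) {ι : Type*} (s : Finset ι) (f : ι → R) :
    darbouxApply u (∑ i ∈ s, f i) = ∑ i ∈ s, darbouxApply u (f i) :=
  map_sum (AddMonoidHom.mk' (darbouxApply u) (darbouxApply_add u)) f s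

end PDO

namespace Iterates

open PDO

variable {R : Type*} [CommRing R] [Differential R] [Algebra ℚ R] {L : PDO R} {Φ Ψ : R}
  {P : Iterates R}

/-- The variation of `Φ` produced by the commutator with `X⁽¹⁾_K`. -/
noncomputable def varΦ (P : Iterates R) (K : ℕ) : R :=
  algebraMap ℚ R (((K : ℚ) + 1) / 2) * P.φ K + ∑ j ∈ Finset.range K,
    algebraMap ℚ R ((j : ℚ) - ((K : ℚ) - 1) / 2) * (P.φ (K - 1 - j) * P.Ω 0 j)

theorem X_eq (P : Iterates R) (K : ℕ) : P.X K = ∑ j ∈ Finset.range K,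
    rat ((j : ℚ) - ((K : ℚ) - 1) / 2) * fDinvg (P.φ (K - 1 - j)) (P.ψ j) := rfl

namespace IsFor

/-- Commuting with L shifts φ_{K-1-j} D⁻¹ ψⱼ to a difference of consecutive terms φ_{K-j} D⁻¹ ψⱼ.
Summing by parts against weights of step one yields minus their full sum, which is (Lᴷ⁺¹)₋; the end
terms and the integrals have Ψ on the right or Φ on the left. -/
theorem neg_lie_X (hP : P.IsFor L Φ Ψ) (hL : L.neg = fDinvg Φ Ψ) (K : ℕ) :
    ∃ q, (⁅P.X K, L⁆).neg = -(L ^ (K + 1)).neg + (fDinvg (P.varΦ K) Ψ - fDinvg Φ q) := by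
  refine ⟨-(algebraMap ℚ R (((K : ℚ) + 1) / 2) * P.ψ K + ∑ j ∈ Finset.range K,
    algebraMap ℚ R ((j : ℚ) - ((K : ℚ) - 1) / 2) * (P.Ω (K - 1 - j) 0 * P.ψ j)), ?_⟩
  have h1 : (⁅P.X K, L⁆).neg = ∑ j ∈ Finset.range K, rat ((j : ℚ) - ((K : ℚ) - 1) / 2) *
      ((fDinvg (P.φ (K - (j + 1))) (P.ψ (j + 1)) - fDinvg (P.φ (K - j)) (P.ψ j)) +
        (fDinvg (P.φ (K - 1 - j) * P.Ω 0 j) Ψ + fDinvg Φ (P.Ω (K - 1 - j) 0 * P.ψ j))) := by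
    rw [X_eq, Ring.lie_def, Finset.sum_mul, Finset.mul_sum, ← Finset.sum_sub_distrib,
      neg_part_sum]
    refine Finset.sum_congr rfl fun j hj => ?_
    have hj' : j < K := by simpa using hj
    rw [← mul_assoc L, ← rat_mul_comm, mul_assoc, mul_assoc, ← mul_sub, rat_apply, neg_ofFun_mul,
      neg_part_sub, hP.neg_ψ_mul hL, hP.neg_mul_φ hL, show K - 1 - j + 1 = K - j by omega,
      show K - (j + 1) = K - 1 - j by omega]
    congr 1
    abel
  rw [h1]
  simp only [mul_add, Finset.sum_add_distrib]
  rw [sum_rat_mul_sub (fun j => fDinvg (P.φ (K - j)) (P.ψ j)), hP.neg_pow hL,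
    Finset.sum_range_succ, varΦ, fDinvg_neg_right, fDinvg_add_left, fDinvg_add_right,
    fDinvg_sum_left, fDinvg_sum_right]
  simp only [← rat_mul_fDinvg']
  simp only [← rat_mul_fDinvg, Nat.add_sub_cancel, Nat.sub_self, Nat.sub_zero, hP.φ_zero,
    hP.ψ_zero]
  rw [show ((K : ℚ) - 1) / 2 = ((K : ℚ) + 1) / 2 - 1 by ring, map_sub, map_one, sub_mul, one_mul]
  abel

/-- The operators `X⁽¹⁾_K` before and after the Darboux-Bäcklund transformation. -/
theorem X_darboux {u : Rˣ} (hP : P.IsFor L u Ψ) (hL : L.neg = fDinvg (u : R) Ψ)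
    (hL' : ((PDO.darboux u : PDO R) * L * (((PDO.darboux u)⁻¹ : (PDO R)ˣ) : PDO R)).neg =
      fDinvg (darbouxApply u (P.φ 1)) ((u⁻¹ : Rˣ) : R)) (K : ℕ) :
    (P.darboux u).X K =
      (PDO.darboux u : PDO R) * P.X K * (((PDO.darboux u)⁻¹ : (PDO R)ˣ) : PDO R) +
      (((PDO.darboux u : PDO R) * L * (((PDO.darboux u)⁻¹ : (PDO R)ˣ) : PDO R)) ^ K).neg -
      fDinvg (darbouxApply u (P.varΦ K)) ((u⁻¹ : Rˣ) : R) := by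
  set b : ℕ → PDO R := fun j => fDinvg (darbouxApply u (P.φ (K - j))) ((P.darboux u).ψ j) with hb
  have hbφ : ∀ j ∈ Finset.range K, fDinvg ((P.darboux u).φ (K - 1 - j)) ((P.darboux u).ψ j) =
      b j := fun j hj => by
    have hj' : j < K := by simpa using hj
    show fDinvg (darbouxApply u (P.φ (K - 1 - j + 1))) _ = _
    rw [show K - 1 - j + 1 = K - j by omega]
  -- The last end term contains T(Φ) = 0. Conjugation by T carries the j-th term of X to b (j + 1)
  -- plus an integral term, whereas X̃ pairs the same weight with b j.
  have hbK : b K = 0 := by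
    simp only [hb, Nat.sub_self, hP.φ_zero, darbouxApply_self, fDinvg_zero_left]
  have h1 : (PDO.darboux u : PDO R) * P.X K * (((PDO.darboux u)⁻¹ : (PDO R)ˣ) : PDO R) =
      ∑ j ∈ Finset.range K, rat ((j : ℚ) - ((K : ℚ) - 1) / 2) *
        (b (j + 1) + fDinvg (darbouxApply u (P.φ (K - 1 - j) * P.Ω 0 j)) ((u⁻¹ : Rˣ) : R)) := by
    rw [X_eq, Finset.mul_sum, Finset.sum_mul]
    refine Finset.sum_congr rfl fun j hj => ?_
    have hψ : (P.darboux u).ψ (j + 1) = -(((u⁻¹ : Rˣ) : R) * P.Ω 0 j) := rfl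
    rw [← mul_assoc, ← rat_mul_comm, mul_assoc, mul_assoc, fDinvg_mul_darboux_inv u
      (ω := P.Ω 0 j) (by rw [hP.deriv_Ω, hP.φ_zero, mul_comm]), mul_sub, darboux_mul_fDinvg,
      darboux_mul_fDinvg]
    simp only [hb, hψ]
    rw [fDinvg_neg_right, show K - (j + 1) = K - 1 - j by omega, mul_comm (P.Ω 0 j), mul_assoc,
      mul_comm (P.Ω 0 j)]
    congr 1
    abel
  have h2 := sum_rat_mul_sub b K
  simp only [mul_sub, Finset.sum_sub_distrib] at h2
  rw [hbK, mul_zero, zero_add] at h2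
  have h3 : rat (((K : ℚ) + 1) / 2) * b 0 = fDinvg (darbouxApply u
      (algebraMap ℚ R (((K : ℚ) + 1) / 2) * P.φ K)) ((u⁻¹ : Rˣ) : R) := by
    rw [darbouxApply_const_mul u (deriv_algebraMap_rat _), ← rat_mul_fDinvg]
    rfl
  have h4 : ∀ j : ℕ, darbouxApply u (algebraMap ℚ R ((j : ℚ) - ((K : ℚ) - 1) / 2) *
      (P.φ (K - 1 - j) * P.Ω 0 j)) = algebraMap ℚ R ((j : ℚ) - ((K : ℚ) - 1) / 2) *
        darbouxApply u (P.φ (K - 1 - j) * P.Ω 0 j) :=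
    fun j => darbouxApply_const_mul u (deriv_algebraMap_rat _) _
  rw [h1, (hP.darboux hL).neg_pow hL', X_eq, Finset.sum_congr rfl hbφ,
    Finset.sum_congr rfl fun j hj => by rw [hbφ j hj], varΦ, darbouxApply_add, fDinvg_add_left,
    ← h3,
    darbouxApply_sum, fDinvg_sum_left]
  simp only [h4, ← rat_mul_fDinvg, mul_add, Finset.sum_add_distrib]
  rw [sub_eq_iff_eq_add] at h2
  rw [h2]
  abel

end IsFor

end Iterates

/-! ### The proposition -/

theorem proposition4p2 {R : Type*} [CommRing R] [Algebra ℚ R] [Differential R]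
    [TopologicalSpace R] [IsTopologicalRing R] [T2Space R]
    (hcont : Continuous fun f : R => f′)
    (T : KPTimes R) (r : ℕ) (hr : 1 ≤ r)
    -- a solution of the constrained hierarchy, with `Φ` and `Ψ` invertible
    (S : LaxSystem R) (hS : S.IsCKP T r)
    (u : Rˣ) (hu : (u : R) = S.Φ) (hΨ : IsUnit S.Ψ)
    (P : Iterates R) (hP : P.IsFor (S.lax r) S.Φ S.Ψ)
    -- the operator `M`, with `(M Lᵏ)₋` well defined
    (E : PDO R) (hE : ∀ n, 1 ≤ n → PDO.mapDer (T.flow n) E = 0)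
    (k : ℕ)
    (hM : ∀ n : ℤ, n < 0 → Summable fun l => (S.orlov T r E l * S.lax r ^ k).coeff n)
    -- the flow `∂*_k`, defined by its action on `L`
    (δ : Derivation ℤ R R) (hδ : ∀ f : R, δ (f′) = (δ f)′)
    (hflow : PDO.mapDer δ (S.lax r) = additionalFlow (S.lax r) (S.orlov T r E) P k)
    -- the Darboux-Bäcklund transforms of all these objects
    (S' : LaxSystem R) (hS' : S' = S.darboux u P)
    (P' : Iterates R) (hP' : P' = P.darboux u)
    (L' : PDO R)
    (hL' : L' = PDO.darboux u * S.lax r * ((PDO.darboux u)⁻¹ : (PDO R)ˣ))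
    (M' : ℕ → PDO R)
    (hM' : ∀ l, M' l = PDO.darboux u * S.orlov T r E l * ((PDO.darboux u)⁻¹ : (PDO R)ˣ)) :
    -- they again form a solution of the constrained hierarchy
    L' = S'.lax r ∧ S'.IsCKP T r ∧ P'.IsFor L' S'.Φ S'.Ψ ∧
    (∀ n : ℤ, n < 0 → Summable fun l => (M' l * L' ^ k).coeff n) ∧
    -- the explicit formula
    PDO.mapDer δ L' = additionalFlow L' M' P' k + isospectral T r k L' ∧
    -- any other admissible integration constants change it only by isospectral flows
    (∀ Q : Iterates R, Q.IsFor L' S'.Φ S'.Ψ → ∃ c : ℕ → R, (∀ j, (c j)′ = 0) ∧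
      PDO.mapDer δ L' = additionalFlow L' M' Q k + isospectral T r k L' +
        ∑ j ∈ Finset.Icc 1 (k - 2), PDO.ofFun (c j) * PDO.mapDer (T.flow (r * j)) L') := by
  open PDO in
  have hCKP := LaxSystem.isCKP_darboux hS hu hP
  have hlax : L' = (S.darboux u P).lax r := by
    rw [hL', LaxSystem.lax, LaxSystem.lax, LaxSystem.root_darboux]
  have hneg' : L'.neg = fDinvg (darbouxApply u (P.φ 1)) ((u⁻¹ : Rˣ) : R) := by
    rw [hlax]
    exact hCKP.constraint
  obtain ⟨v, hv⟩ := hΨ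
  have hL : (S.lax r).neg = fDinvg (u : R) (v : R) := by rw [hS.constraint, hu, hv]
  rw [← hu, ← hv] at hP
  have hPd : (P.darboux u).IsFor L' (darbouxApply u (P.φ 1)) ((u⁻¹ : Rˣ) : R) := by
    rw [hL']
    exact hP.darboux hL
  -- the isospectral flows of the transformed operator
  have hiso : ∀ j, 1 ≤ j → mapDer (T.flow (r * j)) L' = -⁅(L' ^ j).neg, L'⁆ := by
    intro j hj
    have h := LaxSystem.IsCKP.mapDer_root hCKP.sato (Nat.mul_pos hr hj : 1 ≤ r * j) r
    rw [← LaxSystem.lax_pow] at h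
    rw [hlax]
    exact h
  have hiso' : isospectral T r k L' = -⁅(L' ^ (k - 1)).neg, L'⁆ := by
    rw [isospectral]
    split_ifs with h
    · exact hiso (k - 1) (by omega)
    -- Truncated subtraction is harmless: for k = 0 and k = 1 the power is L̃⁰ = 1, with no purely
    -- pseudo-differential part.
    · rw [show k - 1 = 0 by omega, pow_zero, neg_part_eq_zero isDiff_one, Ring.lie_def,
        zero_mul, mul_zero, sub_zero, neg_zero]
  -- the purely pseudo-differential part of `M Lᵏ` and its commutator with `L`
  set L := S.lax r with hLdef
  set A : ℕ → PDO R := fun l => S.orlov T r E l * L ^ k with hA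
  have hN : HasCoeffSum (fun l => (A l).neg) (negSum A) := hasCoeffSum_negSum hM
  have hord : ∀ l, (A l).neg.OrdLE (-1) := fun l => ordLE_neg _
  -- As the [A_l, L] add up to -Lᵏ, this is the sum of the [(A_l)₊, L]₋, expressed without the
  -- series of the (A_l)₊, about which nothing is assumed.
  set Z := (-L ^ k - ⁅negSum A, L⁆).neg with hZdef
  have hZ : HasCoeffSum (fun l => fDinvg ((A l).posApply u) (v : R) -
      fDinvg (u : R) ((A l).posAdjApply v)) Z := by
    have h := ((hasCoeffSum_ite 1 (-L ^ k)).sub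
      ((hN.mul_right hord L).sub (hN.mul_left hcont hord L))).neg_part
    rw [hZdef, Ring.lie_def]
    convert h using 2 with l
    have hl : (if l = 1 then -L ^ k else 0) = A l * L - L * A l :=
      (LaxSystem.orlov_lie T hr S (hE 1 le_rfl) k l).symm.trans (Ring.lie_def _ _)
    rw [hl, ← posApply_pos, ← posAdjApply_pos,
      ← neg_isDiff_mul_fDinvg (isDiff_pos _), ← neg_fDinvg_mul_isDiff (isDiff_pos _), ← hL,
      ← neg_isDiff_mul (isDiff_pos _), ← neg_mul_isDiff (isDiff_pos _), ← neg_part_sub]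
    congr 1
    rw [pos]
    noncomm_ring
  -- T(f) = Φ (Φ⁻¹ f)′ is Φ times the quantity that `logVar` recovers, so this series converges even
  -- if that of the (A_l)₊(Φ) does not.
  have hs : HasSum (fun l => darbouxApply u ((A l).posApply u)) (u * logVar u v Z) := by
    have h := (hZ.logVar hcont u v).mul_left (u : R)
    simp only [logVar_fDinvg] at h
    exact h
  have hMA : ∀ l, M' l * L' ^ k = (PDO.darboux u : PDO R) * A l *
      (((PDO.darboux u)⁻¹ : (PDO R)ˣ) : PDO R) := fun l => by
    rw [hM', hL', Units.conj_pow]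
    simp only [hA, mul_assoc, Units.inv_mul_cancel_left]
  have hMsum : HasCoeffSum (fun l => (M' l * L' ^ k).neg)
      ((PDO.darboux u : PDO R) * negSum A * (((PDO.darboux u)⁻¹ : (PDO R)ˣ) : PDO R) +
        fDinvg (u * logVar u v Z) ((u⁻¹ : Rˣ) : R)) := by
    simp only [hMA, neg_darboux_conj]
    exact ((hN.mul_left hcont hord _).mul_right (fun l => (ordLE_darboux u).mul (hord l)) _).add
      (hasCoeffSum_fDinvg hs _)
  -- the action of the flow on `Φ`, up to a constant factor
  have hX : ∃ q, (⁅P.X (k - 1), L⁆).neg =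
      -(L ^ k).neg + (fDinvg (P.varΦ (k - 1)) (v : R) - fDinvg (u : R) q) := by
    cases k with
    | zero =>
      -- For k = 0 the index k - 1 truncates to 0, where `varΦ` is Φ/2 rather than zero; taking q =
      -- Ψ/2 cancels it.
      refine ⟨algebraMap ℚ R (1 / 2) * v, ?_⟩
      have h0 : P.varΦ 0 = algebraMap ℚ R (1 / 2) * u := by
        simp [Iterates.varΦ, hP.φ_zero]
      have h1 : P.X 0 = 0 := Finset.sum_range_zero _
      rw [← rat_mul_fDinvg', rat_mul_fDinvg, pow_zero, neg_part_eq_zero isDiff_one, Nat.zero_sub,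
        h0, h1, sub_self, neg_zero, add_zero, Ring.lie_def, zero_mul, mul_zero, sub_zero]
      exact neg_part_eq_zero fun _ _ => rfl
    | succ K => exact hP.neg_lie_X hL K
  -- The purely pseudo-differential part of δL is computed once from Φ D⁻¹ Ψ and once from the flow,
  -- where the two Lᵏ terms cancel; applying `logVar` eliminates δΨ.
  have hδu : darbouxApply u (δ u) = u * logVar u v Z + darbouxApply u (P.varΦ (k - 1)) := by
    obtain ⟨q, hq⟩ := hX
    have h1 : (mapDer δ L).neg = Z + (fDinvg (P.varΦ (k - 1)) (v : R) - fDinvg (u : R) q) := by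
      have h2 : ⁅-negSum A + P.X (k - 1), L⁆ = (-L ^ k - ⁅negSum A, L⁆) + L ^ k +
          ⁅P.X (k - 1), L⁆ := by
        simp only [Ring.lie_def]
        noncomm_ring
      rw [hflow, additionalFlow, h2, neg_part_add, neg_part_add, hq, ← hZdef]
      abel
    rw [← mapDer_neg_part, hL, mapDer_fDinvg hδ, ← sub_neg_eq_add, ← fDinvg_neg_right] at h1
    have h3 := congrArg (logVar u v) h1
    rw [logVar_add, logVar_fDinvg, logVar_fDinvg] at h3
    rw [darbouxApply, darbouxApply, h3, mul_add]
  have hXd := hP.X_darboux hL (by rw [← hL']; exact hneg') (k - 1)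
  rw [← hL'] at hXd
  have hmain : mapDer δ L' = additionalFlow L' M' (P.darboux u) k + isospectral T r k L' := by
    have h1 := mapDer_conj hδ (PDO.darboux u) (mapDer_darboux u hδ) hflow
    have h2 : ∀ G : PDO R, (PDO.darboux u : PDO R) * ⁅G, L⁆ *
        (((PDO.darboux u)⁻¹ : (PDO R)ˣ) : PDO R) =
          ⁅(PDO.darboux u : PDO R) * G * (((PDO.darboux u)⁻¹ : (PDO R)ˣ) : PDO R), L'⁆ := by
      intro G
      rw [hL', Ring.lie_def, Ring.lie_def]
      simp only [mul_assoc, Units.inv_mul_cancel_left, mul_sub, sub_mul]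
    rw [← hL', additionalFlow, h2, mul_add, mul_neg, add_mul, neg_mul, hδu, fDinvg_add_left] at h1
    rw [h1, additionalFlow, negSum_eq hMsum, hXd, hiso']
    simp only [Ring.lie_def]
    noncomm_ring
  rw [hS', hP']
  refine ⟨hlax, hCKP, hPd, fun n hn => ?_, hmain, fun Q hQ => ?_⟩
  · have h := (hMsum n).summable
    simpa only [coeff_neg_part, if_pos hn] using h
  · obtain ⟨d, hd, hdX⟩ := hPd.exists_X_eq hneg' hQ
    -- Here K = k - 1 in `exists_X_eq`. The constants are central, so d (L̃ʲ)₋ added to X̃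
    -- contributes -d ∂L̃/∂t_{rj} to the commutator, which the correction sum compensates.
    refine ⟨fun j => d (k - 1 - j), fun j => hd _, ?_⟩
    have h1 : ∀ j ∈ Finset.Icc 1 (k - 2), ofFun (d (k - 1 - j)) * mapDer (T.flow (r * j)) L' =
        L' * (ofFun (d (k - 1 - j)) * (L' ^ j).neg) -
          ofFun (d (k - 1 - j)) * (L' ^ j).neg * L' := by
      intro j hj
      rw [hiso j (Finset.mem_Icc.mp hj).1, ← mul_assoc L', ← ofFun_mul_comm_of_deriv_eq_zero (hd _),
        Ring.lie_def]
      noncomm_ring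
    rw [Finset.sum_congr rfl h1, Finset.sum_sub_distrib, ← Finset.mul_sum, ← Finset.sum_mul, hmain,
      additionalFlow, additionalFlow, hdX, show k - 1 - 1 = k - 2 by omega]
    simp only [Ring.lie_def]
    noncomm_ring
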